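/- Let $q\in\mathbb C$ with $q\neq 0$, $|q|\neq 1$, and fix a square root $q^{1/2}$ (with $q^{a/2}=(q^{1/2})^a$ for $a\in\mathbb Z$, and $(q^{-1})^{1/2}=(q^{1/2})^{-1}$). Write $(a;q)_k=\prod_{i=0}^{k-1}(1-aq^i)$ and, for $|q|<1$, $(a;q)_\infty=\prod_{i\ge 0}(1-aq^i)$. For $|q|<1$ let $\theta(x;q)=(-q^{1/2}x;q)_\infty(-q^{1/2}x^{-1};q)_\infty$, and extend it by $\theta(x;q^{-1})=1/\theta(x;q)$. Let $$G(x,y,z,q)=c(x,y,q)\sum_{k\ge 0}\frac{z^k}{(q^{-1};q^{-1})_k(qx;q)_k(qy;q)_k},$$ where $c(x,y,q)=(qx;q)_\infty(qy;q)_\infty$ if $|q|<1$ and $c(x,y,q)=\dfrac1{(x;q^{-1})_\infty(y;q^{-1})_\infty}$ if $|q|>1$. The holomorphic blocks of the $5_2$ knot are $$B^{(1)}(x;q)=\theta(x;q)G(x,x^{-1},1,q),\qquad B^{(2)}(x;q)=\frac{\theta(x;q)}{\theta(-q^{1/2}x;q)}G(x,x^2,x,q),\qquad B^{(3)}(x;q)=\frac{\theta(x^{-1};q)}{\theta(-q^{1/2}x^{-1};q)}G(x^{-1},x^{-2},x^{-1},q).$$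 Let $\wp(u)$ be the Weierstrass function with period lattice $2\pi i\,\mathbb Z+\log(q)\,\mathbb Z$ and $\wp'=d\wp/du$. The colored holomorphic blocks $h^{(\alpha)}_n(q)$, $\alpha=0,1,2$, $n\in\mathbb Z$, are defined by the following expansions as $u\to 0$, $u\ne0$. For $|q|<1$, $$B^{(1)}(q^ne^u;q)=(-q^{1/2};q)_\infty^2(q;q)_\infty^2\,h^{(0)}_n(q)+O(u),$$ $$B^{(2)}(q^ne^u;q)+B^{(3)}(q^ne^u;q)=-2(-q^{1/2};q)_\infty^2\,h^{(1)}_n(q)+O(u),$$ $$-B^{(1)}(q^ne^u;q)\frac{\wp'(u)}{\wp(u)(q;q)_\infty^2}-B^{(2)}(q^ne^u;q)+B^{(3)}(q^ne^u;q)=(-q^{1/2};q)_\infty^2\,h^{(2)}_n(q)\,u+O(u^2),$$ and, still for $|q|<1$, the functions outside the unit disk are defined by $$-B^{(1)}(q^{-n}e^{-u};q^{-1})=\frac{h^{(0)}_n(q^{-1})}{(-q^{1/2};q)_\infty^2(q;q)_\infty^2}\,u^{-2}+O(u^{-1}),$$ $$B^{(2)}(q^{-n}e^{-u};q^{-1})+B^{(3)}(q^{-n}e^{-u};q^{-1})=\frac{h^{(1)}_n(q^{-1})}{(-q^{1/2};q)_\infty^2}+O(u),$$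 $$2\Big(2B^{(1)}(q^{-n}e^{-u};q^{-1})\frac{\wp(u)(q;q)_\infty^2}{\wp'(u)}-B^{(2)}(q^{-n}e^{-u};q^{-1})+B^{(3)}(q^{-n}e^{-u};q^{-1})\Big)=\frac{h^{(2)}_n(q^{-1})}{(-q^{1/2};q)_\infty^2}\,u+O(u^2).$$ For $\ell=1,2$ let $E_\ell(q)=\frac{\zeta(1-\ell)}2+\sum_{s\ge1}s^{\ell-1}\frac{q^s}{1-q^s}$ for $|q|<1$, extended to $|q|>1$ by $E_\ell(q^{-1})=-E_\ell(q)$, and let $H_n(q)=\sum_{j=1}^n\frac{q^j}{1-q^j}$, $H^{(2)}_n(q)=\sum_{j=1}^n\frac{q^j}{(1-q^j)^2}$. For $n\in\mathbb Z$ and $k\ge0$ put $$T_{n,k}(q)=\frac{q^{|n|k}}{(q^{-1};q^{-1})_k(q;q)_{k+2|n|}(q;q)_{k+|n|}},\qquad L_{n,k}(q)=k+|n|-\tfrac14-3E_1(q)+H_k(q)+H_{k+|n|}(q)+H_{k+2|n|}(q).$$ Lemma. For every $q\ne0$ with $|q|\neq1$, every choice of $q^{1/2}$ and every $n\in\mathbb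 Z$, each of the above expansions holds for exactly one value of its coefficient $h^{(\alpha)}_n$, the infinite series below converge absolutely, and $$h^{(0)}_n(q)=(-1)^nq^{|n|/2}\sum_{k=0}^\infty T_{n,k}(q),$$ $$h^{(1)}_n(q)=-(-1)^nq^{|n|/2}\sum_{k=0}^\infty T_{n,k}(q)L_{n,k}(q)+q^{-n^2/2}\sum_{k=0}^{|n|-1}\frac{(q^{-1};q^{-1})_{|n|-1-k}}{(q^{-1};q^{-1})_k(q;q)_{k+|n|}},$$ $$\begin{aligned}h^{(2)}_n(q)={}&(-1)^nq^{|n|/2}\sum_{k=0}^\infty T_{n,k}(q)\Big(E_2(q)+\tfrac18-H^{(2)}_k(q)-H^{(2)}_{k+|n|}(q)-H^{(2)}_{k+2|n|}(q)-L_{n,k}(q)^2\Big)\\&+2q^{-n^2/2}\sum_{k=0}^{|n|-1}\frac{(q^{-1};q^{-1})_{|n|-1-k}}{(q^{-1};q^{-1})_k(q;q)_{k+|n|}}\Big(|n|-\tfrac34-3E_1(q)+H_k(q)+H_{k+|n|}(q)+H_{|n|-k-1}(q)\Big)\\&-2(-1)^nq^{-|n|/2}\sum_{k=0}^{|n|-1}q^{-|n|k}\frac{(q^{-1};q^{-1})_{2|n|-k-1}(q^{-1};q^{-1})_{|n|-k-1}}{(q^{-1};q^{-1})_k}.\end{aligned}$$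 Moreover $h^{(\alpha)}_{-n}(q)=h^{(\alpha)}_n(q)$ for $\alpha=0,1,2$. -/

import Mathlib

open Filter Topology Asymptotics

namespace Knot52

noncomputable section

/-- The finite `q`-Pochhammer symbol `(a; q)_k = ∏_{i < k} (1 - a q^i)`. -/
def qPoch (a q : ℂ) (k : ℕ) : ℂ := ∏ i ∈ Finset.range k, (1 - a * q ^ i)

/-- The infinite `q`-Pochhammer symbol `(a; q)_∞ = ∏_{i ≥ 0} (1 - a q^i)`, used for `|q| < 1`. -/
def qPochInf (a q : ℂ) : ℂ := ∏' i : ℕ, (1 - a * q ^ i)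

/-- The theta function `θ(x; q) = (-q^{1/2} x; q)_∞ (-q^{1/2} x⁻¹; q)_∞` for `|q| < 1`, extended to
`|q| > 1` by `θ(x; q⁻¹) = θ(x; q)⁻¹`. Here and below `s` is the chosen square root of `q`,
so that `q = s ^ 2`. -/
def theta (x s : ℂ) : ℂ :=
  if ‖s‖ < 1 then qPochInf (-s * x) (s ^ 2) * qPochInf (-s * x⁻¹) (s ^ 2)
  else (qPochInf (-s⁻¹ * x) (s⁻¹ ^ 2) * qPochInf (-s⁻¹ * x⁻¹) (s⁻¹ ^ 2))⁻¹

/-- The function `G(x, y, z, q)` for `|q| < 1` and for `|q| > 1`. -/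
def G (x y z q : ℂ) : ℂ :=
  if ‖q‖ < 1 then
    qPochInf (q * x) q * qPochInf (q * y) q *
      ∑' k : ℕ, z ^ k / (qPoch q⁻¹ q⁻¹ k * qPoch (q * x) q k * qPoch (q * y) q k)
  else
    1 / (qPochInf x q⁻¹ * qPochInf y q⁻¹) *
      ∑' k : ℕ, z ^ k / (qPoch q⁻¹ q⁻¹ k * qPoch (q * x) q k * qPoch (q * y) q k)

/-- The holomorphic block `B^{(1)}(x; q)`, `q = s ^ 2`. -/
def B1 (x s : ℂ) : ℂ := theta x s * G x x⁻¹ 1 (s ^ 2)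

/-- The holomorphic block `B^{(2)}(x; q)`, `q = s ^ 2`. -/
def B2 (x s : ℂ) : ℂ := theta x s / theta (-s * x) s * G x (x ^ 2) x (s ^ 2)

/-- The holomorphic block `B^{(3)}(x; q)`, `q = s ^ 2`. -/
def B3 (x s : ℂ) : ℂ :=
  theta x⁻¹ s / theta (-s * x⁻¹) s * G x⁻¹ (x⁻¹ ^ 2) x⁻¹ (s ^ 2)

/-- The periods `2πi` and `log q`, `q = s ^ 2`. The lattice they span does not depend on the branch
of the logarithm, and it consists of the `u` for which `e^u` is an integral power of `q`. -/
def periods (s : ℂ) (hs0 : s ≠ 0) (hs1 : ‖s‖ ≠ 1) : PeriodPair where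
  ω₁ := 2 * Real.pi * Complex.I
  ω₂ := Complex.log (s ^ 2)
  indep := by
    rw [LinearIndependent.pair_iff]
    intro a b h
    have hre := congrArg Complex.re h
    simp only [Complex.add_re, Complex.real_smul, Complex.mul_re, Complex.ofReal_re,
      Complex.ofReal_im, Complex.log_re, Complex.I_re, Complex.I_im, Complex.mul_im,
      Complex.zero_re, norm_pow, Real.log_pow] at hre
    have hlog : Real.log ‖s‖ ≠ 0 :=
      Real.log_ne_zero_of_pos_of_ne_one (norm_pos_iff.mpr hs0) hs1
    have hb : b = 0 := by
      norm_num at hre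
      rcases hre with h1 | h1
      · exact h1
      · exfalso
        have := norm_pos_iff.mpr hs0
        rcases h1 with h2 | h2 | h2
        · exact hs0 h2
        · exact hs1 h2
        · linarith
    refine ⟨?_, hb⟩
    subst hb
    simpa [Complex.real_smul, Real.pi_ne_zero] using h

/-- The quotient `℘'(e^u, q) / ℘(e^u, q)`, where `℘` is the Weierstrass function of the variable `u`
with period lattice `2πi ℤ + log q ℤ`, `q = s ^ 2`. -/
def wpLogDeriv (s : ℂ) (hs0 : s ≠ 0) (hs1 : ‖s‖ ≠ 1) (u : ℂ) : ℂ :=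
  (periods s hs0 hs1).derivWeierstrassP u / (periods s hs0 hs1).weierstrassP u

/-- For `|q| < 1`, `q = s ^ 2`: the number `h` is the coefficient that defines `h^{(α)}_n(q)`
through the expansion at `u = 0` of the holomorphic blocks at `x = q^n e^u`. -/
def IsBlockInside (α : Fin 3) (n : ℤ) (s : ℂ) (hs0 : s ≠ 0) (hs1 : ‖s‖ ≠ 1) (h : ℂ) : Prop :=
  let q : ℂ := s ^ 2
  let x : ℂ → ℂ := fun u => q ^ n * Complex.exp u
  match α with
  | 0 => (fun u : ℂ => B1 (x u) s - qPochInf (-s) q ^ 2 * qPochInf q q ^ 2 * h)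
      =O[𝓝[≠] 0] fun u : ℂ => u
  | 1 => (fun u : ℂ => B2 (x u) s + B3 (x u) s - (-2 * qPochInf (-s) q ^ 2 * h))
      =O[𝓝[≠] 0] fun u : ℂ => u
  | 2 => (fun u : ℂ => -B1 (x u) s * (wpLogDeriv s hs0 hs1 u / qPochInf q q ^ 2)
        - B2 (x u) s + B3 (x u) s - qPochInf (-s) q ^ 2 * h * u)
      =O[𝓝[≠] 0] fun u : ℂ => u ^ 2

/-- For `|q| < 1`, `q = s ^ 2`: the number `h` is the coefficient that defines `h^{(α)}_n(q⁻¹)`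
through the expansion at `u = 0` of the holomorphic blocks in base `q⁻¹` at `x = q^{-n} e^{-u}`. -/
def IsBlockOutside (α : Fin 3) (n : ℤ) (s : ℂ) (hs0 : s ≠ 0) (hs1 : ‖s‖ ≠ 1) (h : ℂ) : Prop :=
  let q : ℂ := s ^ 2
  let x : ℂ → ℂ := fun u => q ^ (-n) * Complex.exp (-u)
  match α with
  | 0 => (fun u : ℂ => -B1 (x u) s⁻¹
        - 1 / (qPochInf (-s) q ^ 2 * qPochInf q q ^ 2) * h * (u ^ 2)⁻¹)
      =O[𝓝[≠] 0] fun u : ℂ => u⁻¹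
  | 1 => (fun u : ℂ => B2 (x u) s⁻¹ + B3 (x u) s⁻¹ - 1 / qPochInf (-s) q ^ 2 * h)
      =O[𝓝[≠] 0] fun u : ℂ => u
  | 2 => (fun u : ℂ => 2 * (2 * B1 (x u) s⁻¹ * (qPochInf q q ^ 2 / wpLogDeriv s hs0 hs1 u)
        - B2 (x u) s⁻¹ + B3 (x u) s⁻¹) - h / qPochInf (-s) q ^ 2 * u)
      =O[𝓝[≠] 0] fun u : ℂ => u ^ 2

/-- The defining property of the value `h = h^{(α)}_n(q)`, `q = s ^ 2`, for `|q| ≠ 1`. -/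
def IsColoredBlock (α : Fin 3) (n : ℤ) (s : ℂ) (hs0 : s ≠ 0) (hs1 : ‖s‖ ≠ 1) (h : ℂ) : Prop :=
  (‖s‖ < 1 → IsBlockInside α n s hs0 hs1 h) ∧
  (1 < ‖s‖ → IsBlockOutside α n s⁻¹ (inv_ne_zero hs0)
    (by rw [norm_inv]; exact fun h1 => hs1 (inv_eq_one.mp h1)) h)

/-- The colored holomorphic block `h^{(α)}_n(q)`, `q = s ^ 2`, `|q| ≠ 1`: the number with the
defining property. -/
def coloredBlock (α : Fin 3) (n : ℤ) (s : ℂ) (hs0 : s ≠ 0) (hs1 : ‖s‖ ≠ 1) : ℂ :=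
  Classical.epsilon (IsColoredBlock α n s hs0 hs1)

/-- `E_ℓ(q) = ζ(1-ℓ)/2 + ∑_{m ≥ 1} m^{ℓ-1} q^m / (1 - q^m)` for `|q| < 1`, extended to `|q| > 1` by
`E_ℓ(q⁻¹) = -E_ℓ(q)`. -/
def E (l : ℕ) (q : ℂ) : ℂ :=
  let e : ℂ → ℂ := fun t =>
    riemannZeta (1 - l) / 2 +
      ∑' m : ℕ, ((m + 1 : ℕ) : ℂ) ^ (l - 1) * (t ^ (m + 1) / (1 - t ^ (m + 1)))
  if ‖q‖ < 1 then e q else -e q⁻¹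

/-- The `q`-harmonic sum `H_n(q) = ∑_{j=1}^n q^j / (1 - q^j)`. -/
def H (n : ℕ) (q : ℂ) : ℂ := ∑ j ∈ Finset.Icc 1 n, q ^ j / (1 - q ^ j)

/-- The `q`-harmonic sum `H^{(2)}_n(q) = ∑_{j=1}^n q^j / (1 - q^j)^2`. -/
def H2 (n : ℕ) (q : ℂ) : ℂ := ∑ j ∈ Finset.Icc 1 n, q ^ j / (1 - q ^ j) ^ 2

/-- The `k`-th summand of the series for `h^{(0)}_n(q)`, as a function of `N = |n|`. -/
def term0 (N : ℕ) (q : ℂ) (k : ℕ) : ℂ :=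
  q ^ (N * k) / (qPoch q⁻¹ q⁻¹ k * qPoch q q (k + 2 * N) * qPoch q q (k + N))

/-- The factor `k + |n| - 1/4 - 3 E_1(q) + H_k(q) + H_{k+|n|}(q) + H_{k+2|n|}(q)`, `N = |n|`. -/
def linFactor (N : ℕ) (q : ℂ) (k : ℕ) : ℂ :=
  (k : ℂ) + N - 1 / 4 - 3 * E 1 q + H k q + H (k + N) q + H (k + 2 * N) q

/-- The `k`-th summand of the infinite series in `h^{(1)}_n(q)`, `N = |n|`. -/
def term1 (N : ℕ) (q : ℂ) (k : ℕ) : ℂ := term0 N q k * linFactor N q k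

/-- The `k`-th summand of the infinite series in `h^{(2)}_n(q)`, `N = |n|`. -/
def term2 (N : ℕ) (q : ℂ) (k : ℕ) : ℂ :=
  term0 N q k *
    (E 2 q + 1 / 8 - H2 k q - H2 (k + N) q - H2 (k + 2 * N) q - linFactor N q k ^ 2)

end

end Knot52

namespace Knot52

noncomputable section

/-- Boundedness on a punctured neighbourhood of `0`. -/
def Bdd (g : ℂ → ℂ) : Prop := g =O[𝓝[≠] 0] fun _ => (1 : ℂ)

theorem Bdd.add {f g : ℂ → ℂ} (hf : Bdd f) (hg : Bdd g) : Bdd fun u => f u + g u :=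
  IsBigO.add hf hg

theorem Bdd.mul {f g : ℂ → ℂ} (hf : Bdd f) (hg : Bdd g) : Bdd fun u => f u * g u := by
  simpa [Bdd] using IsBigO.mul hf hg

theorem Bdd.of_tendsto {f : ℂ → ℂ} {a : ℂ} (h : Tendsto f (𝓝[≠] 0) (𝓝 a)) : Bdd f :=
  h.isBigO_one ℂ

theorem Bdd.of_continuous {f : ℂ → ℂ} (h : Continuous f) : Bdd f :=
  Bdd.of_tendsto ((h.tendsto 0).mono_left nhdsWithin_le_nhds)

theorem Bdd.of_norm_le {f : ℂ → ℂ} {C : ℝ} (h : ∀ᶠ u in 𝓝[≠] 0, ‖f u‖ ≤ C) : Bdd f :=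
  IsBigO.of_bound C (by simpa using h)

theorem tendsto_const_mul_punctured {l : ℂ} (hl : l ≠ 0) :
    Tendsto (fun u : ℂ => l * u) (𝓝[≠] 0) (𝓝[≠] 0) := by
  refine tendsto_nhdsWithin_iff.2 ⟨?_, ?_⟩
  · have : Tendsto (fun u : ℂ => l * u) (𝓝 0) (𝓝 (l * 0)) :=
      (continuous_const.mul continuous_id).tendsto 0
    rw [mul_zero] at this
    exact this.mono_left nhdsWithin_le_nhds
  · filter_upwards [self_mem_nhdsWithin] with u hu
    exact mul_ne_zero hl hu

theorem Bdd.scale {f : ℂ → ℂ} (hf : Bdd f) {l : ℂ} (hl : l ≠ 0) : Bdd fun u => f (l * u) :=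
  IsBigO.comp_tendsto hf (tendsto_const_mul_punctured hl)

/-- `f u = a + b u + c u² + O(u³)` as `u → 0`, `u ≠ 0`. -/
def Jet (f : ℂ → ℂ) (a b c : ℂ) : Prop :=
  ∃ g, Bdd g ∧ ∀ᶠ u in 𝓝[≠] 0, f u = a + b * u + c * u ^ 2 + u ^ 3 * g u

/-- `f u = a exp (b u + c u²) + O(u³)` as `u → 0`, `u ≠ 0`. -/
def LJet (f : ℂ → ℂ) (a b c : ℂ) : Prop := Jet f a (a * b) (a * (b ^ 2 / 2 + c))

namespace Jet

variable {f g : ℂ → ℂ} {a b c a' b' c' : ℂ}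

theorem congr (hf : Jet f a b c) (h : ∀ᶠ u in 𝓝[≠] 0, g u = f u) : Jet g a b c := by
  obtain ⟨r, hr, e⟩ := hf
  refine ⟨r, hr, ?_⟩
  filter_upwards [e, h] with u h1 h2
  rw [h2, h1]

theorem of_eq (hf : Jet f a b c) (ha : a' = a) (hb : b' = b) (hc : c' = c) : Jet f a' b' c' := by
  rwa [ha, hb, hc]

theorem tendsto (hf : Jet f a b c) : Tendsto f (𝓝[≠] 0) (𝓝 a) := by
  obtain ⟨r, hr, e⟩ := hf
  have h0 : Tendsto (fun u : ℂ => u ^ 3 * r u) (𝓝[≠] 0) (𝓝 0) := by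
    have h1 : (fun u : ℂ => u ^ 3 * r u) =O[𝓝[≠] 0] fun u : ℂ => u ^ 3 := by
      simpa using (isBigO_refl (fun u : ℂ => u ^ 3) (𝓝[≠] 0)).mul hr
    refine h1.trans_tendsto ?_
    have : Tendsto (fun u : ℂ => u ^ 3) (𝓝 0) (𝓝 (0 ^ 3)) := (continuous_pow 3).tendsto 0
    simpa using this.mono_left (nhdsWithin_le_nhds (s := {0}ᶜ))
  have h2 : Tendsto (fun u : ℂ => a + b * u + c * u ^ 2) (𝓝[≠] 0) (𝓝 a) := by
    have : Continuous fun u : ℂ => a + b * u + c * u ^ 2 := by fun_prop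
    simpa using (this.tendsto 0).mono_left (nhdsWithin_le_nhds (s := {0}ᶜ))
  have := h2.add h0
  rw [add_zero] at this
  exact this.congr' (e.mono fun u hu => hu.symm)

theorem add (hf : Jet f a b c) (hg : Jet g a' b' c') :
    Jet (fun u => f u + g u) (a + a') (b + b') (c + c') := by
  obtain ⟨r, hr, e⟩ := hf
  obtain ⟨t, ht, e'⟩ := hg
  refine ⟨_, hr.add ht, ?_⟩
  filter_upwards [e, e'] with u h1 h2
  rw [h1, h2]; ring

theorem poly (a b c : ℂ) : Jet (fun u => a + b * u + c * u ^ 2) a b c :=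
  ⟨fun _ => 0, Bdd.of_continuous continuous_const, by simp⟩

theorem const (a : ℂ) : Jet (fun _ => a) a 0 0 := by simpa using poly a 0 0

theorem mul (hf : Jet f a b c) (hg : Jet g a' b' c') :
    Jet (fun u => f u * g u) (a * a') (a * b' + b * a') (a * c' + b * b' + c * a') := by
  obtain ⟨r, hr, e⟩ := hf
  obtain ⟨t, ht, e'⟩ := hg
  have hc : Bdd fun u : ℂ => b * c' + c * b' + c * c' * u := Bdd.of_continuous (by fun_prop)
  have h1 : Bdd fun u : ℂ => a' + b' * u + c' * u ^ 2 := Bdd.of_continuous (by fun_prop)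
  have h2 : Bdd fun u : ℂ => a + b * u + c * u ^ 2 := Bdd.of_continuous (by fun_prop)
  have h3 : Bdd fun u : ℂ => u ^ 3 := Bdd.of_continuous (by fun_prop)
  refine ⟨_, ((hc.add (hr.mul h1)).add (ht.mul h2)).add (h3.mul (hr.mul ht)), ?_⟩
  filter_upwards [e, e'] with u h1 h2
  rw [h1, h2]; ring

theorem const_mul (k : ℂ) (hf : Jet f a b c) : Jet (fun u => k * f u) (k * a) (k * b) (k * c) := by
  simpa using (const k).mul hf

theorem neg (hf : Jet f a b c) : Jet (fun u => -f u) (-a) (-b) (-c) := by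
  simpa using hf.const_mul (-1)

theorem sub (hf : Jet f a b c) (hg : Jet g a' b' c') :
    Jet (fun u => f u - g u) (a - a') (b - b') (c - c') := by
  simpa [sub_eq_add_neg] using hf.add hg.neg

theorem id_mul (hf : Jet f a b c) : Jet (fun u => u * f u) 0 a b := by
  simpa using (poly 0 1 0).mul hf

theorem scale (hf : Jet f a b c) {l : ℂ} (hl : l ≠ 0) :
    Jet (fun u => f (l * u)) a (l * b) (l ^ 2 * c) := by
  obtain ⟨r, hr, e⟩ := hf
  refine ⟨_, (Bdd.of_continuous (continuous_const (y := l ^ 3))).mul (hr.scale hl), ?_⟩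
  filter_upwards [(tendsto_const_mul_punctured hl).eventually e] with u h1
  rw [h1]; ring

theorem inv (hf : Jet f a b c) (ha : a ≠ 0) :
    Jet (fun u => (f u)⁻¹) a⁻¹ (-b / a ^ 2) (b ^ 2 / a ^ 3 - c / a ^ 2) := by
  obtain ⟨r, hr, e⟩ := hf.mul (poly a⁻¹ (-b / a ^ 2) (b ^ 2 / a ^ 3 - c / a ^ 2))
  have hne : ∀ᶠ u in 𝓝[≠] 0, f u ≠ 0 := hf.tendsto.eventually_ne ha
  have hb : Bdd fun u => (f u)⁻¹ := Bdd.of_tendsto (hf.tendsto.inv₀ ha)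
  refine ⟨_, (Bdd.of_continuous (continuous_const (y := -1))).mul (hr.mul hb), ?_⟩
  filter_upwards [e, hne] with u h1 h2
  have h3 : f u * (a⁻¹ + -b / a ^ 2 * u + (b ^ 2 / a ^ 3 - c / a ^ 2) * u ^ 2) = 1 + u ^ 3 * r u := by
    rw [h1]; field_simp; ring
  have h4 : (f u)⁻¹ * (f u * (a⁻¹ + -b / a ^ 2 * u + (b ^ 2 / a ^ 3 - c / a ^ 2) * u ^ 2))
      = a⁻¹ + -b / a ^ 2 * u + (b ^ 2 / a ^ 3 - c / a ^ 2) * u ^ 2 := by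
    rw [← mul_assoc, inv_mul_cancel₀ h2, one_mul]
  rw [← h4, h3]; ring

theorem sum {ι : Type*} (S : Finset ι) {f : ι → ℂ → ℂ} {a b c : ι → ℂ}
    (h : ∀ i ∈ S, Jet (f i) (a i) (b i) (c i)) :
    Jet (fun u => ∑ i ∈ S, f i u) (∑ i ∈ S, a i) (∑ i ∈ S, b i) (∑ i ∈ S, c i) := by
  classical
  induction S using Finset.induction_on with
  | empty => simpa using const 0
  | insert i S hi ih =>
    simp only [Finset.sum_insert hi]
    exact (h i (by simp)).add (ih fun j hj => h j (by simp [hj]))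

theorem exp : Jet Complex.exp 1 1 (1 / 2) := by
  refine ⟨fun u => (Complex.exp u - (1 + u + u ^ 2 / 2)) / u ^ 3, ?_, ?_⟩
  · refine Bdd.of_norm_le (C := 1) ?_
    have hb : ∀ᶠ u : ℂ in 𝓝[≠] 0, ‖u‖ < 1 := by
      have : Metric.ball (0 : ℂ) 1 ∈ 𝓝[≠] (0 : ℂ) :=
        nhdsWithin_le_nhds (Metric.ball_mem_nhds _ one_pos)
      filter_upwards [this] with u hu
      simpa using hu
    filter_upwards [self_mem_nhdsWithin, hb] with u hu h1
    have h := Complex.exp_bound h1.le (n := 3) (by norm_num)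
    simp only [Finset.sum_range_succ, Finset.sum_range_zero, Nat.factorial] at h
    norm_num at h
    have hu' : u ≠ 0 := hu
    rw [norm_div, norm_pow, div_le_one (by positivity)]
    refine h.trans ?_
    nlinarith [pow_nonneg (norm_nonneg u) 3]
  · filter_upwards [self_mem_nhdsWithin] with u hu
    have hu' : u ≠ 0 := hu
    field_simp
    ring

theorem exp_sub_one_div : Jet (fun u => (Complex.exp u - 1) / u) 1 (1 / 2) (1 / 6) := by
  refine ⟨fun u => (Complex.exp u - (1 + u + u ^ 2 / 2 + u ^ 3 / 6)) / u ^ 4, ?_, ?_⟩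
  · refine Bdd.of_norm_le (C := 1) ?_
    have hb : ∀ᶠ u : ℂ in 𝓝[≠] 0, ‖u‖ < 1 := by
      have : Metric.ball (0 : ℂ) 1 ∈ 𝓝[≠] (0 : ℂ) :=
        nhdsWithin_le_nhds (Metric.ball_mem_nhds _ one_pos)
      filter_upwards [this] with u hu
      simpa using hu
    filter_upwards [self_mem_nhdsWithin, hb] with u hu h1
    have h := Complex.exp_bound h1.le (n := 4) (by norm_num)
    simp only [Finset.sum_range_succ, Finset.sum_range_zero, Nat.factorial] at h
    norm_num at h
    have hu' : u ≠ 0 := hu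
    rw [norm_div, norm_pow, div_le_one (by positivity)]
    refine h.trans ?_
    nlinarith [pow_nonneg (norm_nonneg u) 4]
  · filter_upwards [self_mem_nhdsWithin] with u hu
    have hu' : u ≠ 0 := hu
    field_simp
    ring

theorem isBigO₁ (hf : Jet f a b c) : (fun u => f u - a) =O[𝓝[≠] 0] fun u : ℂ => u := by
  obtain ⟨r, hr, e⟩ := hf
  have h : Bdd fun u => b + c * u + u ^ 2 * r u :=
    (Bdd.of_continuous (by fun_prop)).add ((Bdd.of_continuous (by fun_prop)).mul hr)
  have := (isBigO_refl (fun u : ℂ => u) (𝓝[≠] 0)).mul h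
  refine IsBigO.congr' this (e.mono fun u hu => ?_) (Eventually.of_forall fun u => by simp)
  simp only [hu]; ring

theorem isBigO₂ (hf : Jet f a b c) :
    (fun u => f u - (a + b * u)) =O[𝓝[≠] 0] fun u : ℂ => u ^ 2 := by
  obtain ⟨r, hr, e⟩ := hf
  have h : Bdd fun u => c + u * r u :=
    (Bdd.of_continuous (by fun_prop)).add ((Bdd.of_continuous (by fun_prop)).mul hr)
  have := (isBigO_refl (fun u : ℂ => u ^ 2) (𝓝[≠] 0)).mul h
  refine IsBigO.congr' this (e.mono fun u hu => ?_) (Eventually.of_forall fun u => by simp)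
  simp only [hu]; ring

theorem isBigO₃ (hf : Jet f a b c) :
    (fun u => f u - (a + b * u + c * u ^ 2)) =O[𝓝[≠] 0] fun u : ℂ => u ^ 3 := by
  obtain ⟨r, hr, e⟩ := hf
  have := (isBigO_refl (fun u : ℂ => u ^ 3) (𝓝[≠] 0)).mul hr
  refine IsBigO.congr' this (e.mono fun u hu => ?_) (Eventually.of_forall fun u => by simp)
  simp only [hu]; ring

theorem zero_unique (hf : Jet (fun _ => 0) a b c) : a = 0 ∧ b = 0 ∧ c = 0 := by
  have ha : a = 0 := (tendsto_nhds_unique hf.tendsto tendsto_const_nhds)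
  subst ha
  obtain ⟨r, hr, e⟩ := hf
  have hb : b = 0 := by
    have h2 : Tendsto (fun u : ℂ => b + c * u + u ^ 2 * r u) (𝓝[≠] 0) (𝓝 b) := by
      have h3 : Jet (fun u : ℂ => b + c * u + u ^ 2 * 0 + u ^ 3 * 0) b c 0 :=
        ⟨fun _ => 0, Bdd.of_continuous continuous_const, by simp⟩
      have h4 : Tendsto (fun u : ℂ => u ^ 2 * r u) (𝓝[≠] 0) (𝓝 0) := by
        have h5 : (fun u : ℂ => u ^ 2 * r u) =O[𝓝[≠] 0] fun u : ℂ => u ^ 2 := by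
          simpa using (isBigO_refl (fun u : ℂ => u ^ 2) (𝓝[≠] 0)).mul hr
        refine h5.trans_tendsto ?_
        have : Tendsto (fun u : ℂ => u ^ 2) (𝓝 0) (𝓝 (0 ^ 2)) := (continuous_pow 2).tendsto 0
        simpa using this.mono_left (nhdsWithin_le_nhds (s := {0}ᶜ))
      simpa using h3.tendsto.add h4
    refine tendsto_nhds_unique h2 (Tendsto.congr' ?_ tendsto_const_nhds)
    filter_upwards [e, self_mem_nhdsWithin] with u hu hu0
    have hu' : u ≠ 0 := hu0
    apply mul_left_cancel₀ hu'
    rw [mul_zero, hu]; ring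
  subst hb
  refine ⟨rfl, rfl, ?_⟩
  have h2 : Tendsto (fun u : ℂ => c + u * r u) (𝓝[≠] 0) (𝓝 c) := by
    have h4 : Tendsto (fun u : ℂ => u * r u) (𝓝[≠] 0) (𝓝 0) := by
      have h5 : (fun u : ℂ => u * r u) =O[𝓝[≠] 0] fun u : ℂ => u := by
        simpa using (isBigO_refl (fun u : ℂ => u) (𝓝[≠] 0)).mul hr
      exact h5.trans_tendsto (tendsto_id.mono_left nhdsWithin_le_nhds)
    simpa using (tendsto_const_nhds (x := c)).add h4
  refine tendsto_nhds_unique h2 (Tendsto.congr' ?_ tendsto_const_nhds)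
  filter_upwards [e, self_mem_nhdsWithin] with u hu hu0
  have hu' : u ≠ 0 := hu0
  apply mul_left_cancel₀ (pow_ne_zero 2 hu')
  rw [mul_zero, hu]; ring

theorem unique (hf : Jet f a b c) (hg : Jet f a' b' c') : a = a' ∧ b = b' ∧ c = c' := by
  have h := (hf.sub hg).congr (g := fun _ => 0) (by simp)
  simpa [sub_eq_zero] using h.zero_unique

end Jet

namespace LJet

variable {f g : ℂ → ℂ} {a b c a' b' c' : ℂ}

theorem congr (hf : LJet f a b c) (h : ∀ᶠ u in 𝓝[≠] 0, g u = f u) : LJet g a b c :=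
  Jet.congr hf h

theorem const (a : ℂ) : LJet (fun _ => a) a 0 0 := by simpa [LJet] using Jet.const a

theorem mul (hf : LJet f a b c) (hg : LJet g a' b' c') :
    LJet (fun u => f u * g u) (a * a') (b + b') (c + c') := by
  have h := Jet.mul hf hg
  unfold LJet
  convert h using 1 <;> ring

theorem scale (hf : LJet f a b c) {l : ℂ} (hl : l ≠ 0) :
    LJet (fun u => f (l * u)) a (l * b) (l ^ 2 * c) := by
  have h := Jet.scale hf hl
  unfold LJet
  convert h using 1 <;> ring

theorem inv (hf : LJet f a b c) (ha : a ≠ 0) : LJet (fun u => (f u)⁻¹) a⁻¹ (-b) (-c) := by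
  have h := Jet.inv hf ha
  unfold LJet
  convert h using 1 <;> field_simp <;> ring

theorem prod {ι : Type*} (S : Finset ι) {f : ι → ℂ → ℂ} {a b c : ι → ℂ}
    (h : ∀ i ∈ S, LJet (f i) (a i) (b i) (c i)) :
    LJet (fun u => ∏ i ∈ S, f i u) (∏ i ∈ S, a i) (∑ i ∈ S, b i) (∑ i ∈ S, c i) := by
  classical
  induction S using Finset.induction_on with
  | empty => simpa using const 1
  | insert i S hi ih =>
    simp only [Finset.sum_insert hi, Finset.prod_insert hi]
    exact (h i (by simp)).mul (ih fun j hj => h j (by simp [hj]))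

theorem exp : LJet Complex.exp 1 1 0 := by simpa [LJet] using Jet.exp

theorem exp_mul (l : ℂ) : LJet (fun u => Complex.exp (l * u)) 1 l 0 := by
  by_cases hl : l = 0
  · subst hl; simpa using const 1
  · simpa using exp.scale hl

theorem exp_sub_one_div : LJet (fun u => (Complex.exp u - 1) / u) 1 (1 / 2) (1 / 24) := by
  unfold LJet
  convert Jet.exp_sub_one_div using 1
  all_goals norm_num

/-- The factor `1 - a e^u` of a Pochhammer symbol. -/
theorem one_sub_mul_exp {a : ℂ} (ha : 1 - a ≠ 0) :
    LJet (fun u => 1 - a * Complex.exp u) (1 - a) (-(a / (1 - a))) (-(a / (1 - a) ^ 2) / 2) := by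
  have h := (Jet.const 1).sub (Jet.exp.const_mul a)
  unfold LJet
  convert h using 1 <;> field_simp <;> ring

end LJet

theorem norm_dslope_le {f : ℂ → ℂ} {ρ M : ℝ} (hd : DifferentiableOn ℂ f (Metric.ball 0 ρ))
    (hM : ∀ u ∈ Metric.ball (0 : ℂ) ρ, ‖f u‖ ≤ M) :
    ∀ u ∈ Metric.ball (0 : ℂ) ρ, ‖dslope f 0 u‖ ≤ 2 / ρ * M := by
  intro u hu
  have hρ : 0 < ρ := Metric.pos_of_mem_ball hu
  have h := Complex.norm_dslope_le_div_of_mapsTo_ball (R₂ := 2 * M) hd (fun v hv => by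
    rw [Metric.mem_closedBall, dist_eq_norm]
    have h1 := hM v hv
    have h2 := hM 0 (Metric.mem_ball_self hρ)
    have h3 := norm_sub_le (f v) (f 0)
    linarith) hu
  exact h.trans_eq (by ring)

theorem differentiableOn_dslope_ball {f : ℂ → ℂ} {ρ : ℝ} (hρ : 0 < ρ)
    (hd : DifferentiableOn ℂ f (Metric.ball 0 ρ)) :
    DifferentiableOn ℂ (dslope f 0) (Metric.ball 0 ρ) :=
  (Complex.differentiableOn_dslope (Metric.ball_mem_nhds _ hρ)).2 hd

theorem eq_add_mul_dslope (f : ℂ → ℂ) (u : ℂ) : f u = f 0 + u * dslope f 0 u := by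
  have := sub_smul_dslope f 0 u
  simp only [sub_zero, smul_eq_mul] at this
  rw [this]; ring

theorem eventually_mem_ball {ρ : ℝ} (hρ : 0 < ρ) : ∀ᶠ u : ℂ in 𝓝[≠] 0, u ∈ Metric.ball (0 : ℂ) ρ :=
  nhdsWithin_le_nhds (Metric.ball_mem_nhds _ hρ)

/-- Cauchy estimates for the Taylor polynomial of degree two and its remainder. -/
theorem Jet.cauchy {f : ℂ → ℂ} {a b c : ℂ} {ρ M : ℝ} (hρ : 0 < ρ)
    (hd : DifferentiableOn ℂ f (Metric.ball 0 ρ)) (hM : ∀ u ∈ Metric.ball (0 : ℂ) ρ, ‖f u‖ ≤ M)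
    (hf : Jet f a b c) :
    ‖a‖ ≤ M ∧ ‖b‖ ≤ 2 / ρ * M ∧ ‖c‖ ≤ 2 / ρ * (2 / ρ * M) ∧ ∀ u ∈ Metric.ball (0 : ℂ) ρ,
      ‖f u - (a + b * u + c * u ^ 2)‖ ≤ 2 / ρ * (2 / ρ * (2 / ρ * M)) * ‖u‖ ^ 3 := by
  have d1 := differentiableOn_dslope_ball hρ hd
  have d2 := differentiableOn_dslope_ball hρ d1
  have m1 := norm_dslope_le hd hM
  have m2 := norm_dslope_le d1 m1
  have m3 := norm_dslope_le d2 m2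
  set g1 := dslope f 0
  set g2 := dslope g1 0
  set g3 := dslope g2 0
  have key : ∀ u, f u = f 0 + g1 0 * u + g2 0 * u ^ 2 + u ^ 3 * g3 u := by
    intro u
    have e1 : f u = f 0 + u * g1 u := eq_add_mul_dslope f u
    have e2 : g1 u = g1 0 + u * g2 u := eq_add_mul_dslope g1 u
    have e3 : g2 u = g2 0 + u * g3 u := eq_add_mul_dslope g2 u
    rw [e1, e2, e3]; ring
  have hJ : Jet f (f 0) (g1 0) (g2 0) :=
    ⟨g3, Bdd.of_norm_le ((eventually_mem_ball hρ).mono fun u hu => m3 u hu), by simp [← key]⟩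
  obtain ⟨rfl, rfl, rfl⟩ := hf.unique hJ
  have h0 := Metric.mem_ball_self (x := (0 : ℂ)) hρ
  refine ⟨hM 0 h0, m1 0 h0, m2 0 h0, fun u hu => ?_⟩
  have : f u - (f 0 + g1 0 * u + g2 0 * u ^ 2) = u ^ 3 * g3 u := by rw [key u]; ring
  rw [this, norm_mul, norm_pow, mul_comm]
  exact mul_le_mul_of_nonneg_right (m3 u hu) (by positivity)

theorem Jet.of_norm_le {f : ℂ → ℂ} {a b c : ℂ} {ρ C : ℝ} (hρ : 0 < ρ)
    (h : ∀ u ∈ Metric.ball (0 : ℂ) ρ, ‖f u - (a + b * u + c * u ^ 2)‖ ≤ C * ‖u‖ ^ 3) :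
    Jet f a b c := by
  refine ⟨fun u => (f u - (a + b * u + c * u ^ 2)) / u ^ 3, Bdd.of_norm_le (C := C) ?_, ?_⟩
  · filter_upwards [eventually_mem_ball hρ, self_mem_nhdsWithin] with u hu hu0
    have : u ≠ 0 := hu0
    rw [norm_div, norm_pow, div_le_iff₀ (by positivity)]
    exact h u hu
  · filter_upwards [self_mem_nhdsWithin] with u hu0
    have : u ≠ 0 := hu0
    field_simp
    ring

/-- Taylor polynomials pass to limits of uniformly bounded holomorphic functions. -/
theorem Jet.of_tendsto {F : ℕ → ℂ → ℂ} {f : ℂ → ℂ} {A B C : ℕ → ℂ} {a b c : ℂ} {ρ M : ℝ}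
    (hρ : 0 < ρ) (hd : ∀ k, DifferentiableOn ℂ (F k) (Metric.ball 0 ρ))
    (hM : ∀ k, ∀ u ∈ Metric.ball (0 : ℂ) ρ, ‖F k u‖ ≤ M) (hJ : ∀ k, Jet (F k) (A k) (B k) (C k))
    (hF : ∀ u ∈ Metric.ball (0 : ℂ) ρ, Tendsto (fun k => F k u) atTop (𝓝 (f u)))
    (hA : Tendsto A atTop (𝓝 a)) (hB : Tendsto B atTop (𝓝 b)) (hC : Tendsto C atTop (𝓝 c)) :
    Jet f a b c := by
  refine Jet.of_norm_le (C := 2 / ρ * (2 / ρ * (2 / ρ * M))) hρ fun u hu => ?_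
  have ht : Tendsto (fun k => ‖F k u - (A k + B k * u + C k * u ^ 2)‖) atTop
      (𝓝 ‖f u - (a + b * u + c * u ^ 2)‖) :=
    ((hF u hu).sub ((hA.add (hB.mul_const u)).add (hC.mul_const _))).norm
  exact le_of_tendsto ht (Eventually.of_forall fun k => ((hJ k).cauchy hρ (hd k) (hM k)).2.2.2 u hu)

/-- Taylor polynomials of a normally convergent series of holomorphic functions. -/
theorem Jet.tsum {F : ℕ → ℂ → ℂ} {A B C : ℕ → ℂ} {ρ : ℝ} {M : ℕ → ℝ}
    (hρ : 0 < ρ) (hd : ∀ k, DifferentiableOn ℂ (F k) (Metric.ball 0 ρ))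
    (hM : ∀ k, ∀ u ∈ Metric.ball (0 : ℂ) ρ, ‖F k u‖ ≤ M k) (hs : Summable M)
    (hJ : ∀ k, Jet (F k) (A k) (B k) (C k)) :
    Summable A ∧ Summable B ∧ Summable C ∧
      Jet (fun u => ∑' k, F k u) (∑' k, A k) (∑' k, B k) (∑' k, C k) := by
  have hc := fun k => (hJ k).cauchy hρ (hd k) (hM k)
  have sA : Summable A := .of_norm_bounded hs fun k => (hc k).1
  have sB : Summable B := .of_norm_bounded (hs.mul_left _) fun k => (hc k).2.1
  have sC : Summable C := .of_norm_bounded ((hs.mul_left _).mul_left _) fun k => (hc k).2.2.1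
  refine ⟨sA, sB, sC, ?_⟩
  refine Jet.of_norm_le (C := 2 / ρ * (2 / ρ * (2 / ρ * ∑' k, M k))) hρ fun u hu => ?_
  have sF : Summable fun k => F k u := .of_norm_bounded hs fun k => hM k u hu
  have e : ∑' k, F k u - (∑' k, A k + (∑' k, B k) * u + (∑' k, C k) * u ^ 2)
      = ∑' k, (F k u - (A k + B k * u + C k * u ^ 2)) := by
    rw [← tsum_mul_right, ← tsum_mul_right, ← sA.tsum_add (sB.mul_right u),
      ← (sA.add (sB.mul_right u)).tsum_add (sC.mul_right _), ← sF.tsum_sub]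
    exact (sA.add (sB.mul_right u)).add (sC.mul_right _)
  rw [e]
  have hs' := ((((hs.mul_left (2 / ρ)).mul_left (2 / ρ)).mul_left (2 / ρ)).mul_right (‖u‖ ^ 3))
  refine (tsum_of_norm_bounded hs'.hasSum fun k => (hc k).2.2.2 u hu).trans_eq ?_
  rw [tsum_mul_right, tsum_mul_left, tsum_mul_left, tsum_mul_left]

/-- `f` is, to second order, the convergent sum of the `t k * exp (l k * u + c k * u ^ 2)`. -/
structure JetSum (f : ℂ → ℂ) (t l c : ℕ → ℂ) : Prop where
  summable₀ : Summable t
  summable₁ : Summable fun k => t k * l k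
  summable₂ : Summable fun k => t k * (l k ^ 2 / 2 + c k)
  jet : Jet f (∑' k, t k) (∑' k, t k * l k) (∑' k, t k * (l k ^ 2 / 2 + c k))

theorem JetSum.mul {f g : ℂ → ℂ} {t l c : ℕ → ℂ} {a b d : ℂ} (hf : JetSum f t l c)
    (hg : LJet g a b d) :
    JetSum (fun u => g u * f u) (fun k => a * t k) (fun k => b + l k) (fun k => d + c k) := by
  have s1 : (fun k => a * t k * (b + l k)) = fun k => a * b * t k + a * (t k * l k) := by
    ext k; ring
  have s2 : (fun k => a * t k * ((b + l k) ^ 2 / 2 + (d + c k))) =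
      fun k => a * (b ^ 2 / 2 + d) * t k + a * b * (t k * l k)
        + a * (t k * (l k ^ 2 / 2 + c k)) := by
    ext k; ring
  have a0 := hf.summable₀
  have a1 := hf.summable₁
  have a2 := hf.summable₂
  refine ⟨a0.mul_left a, ?_, ?_, ?_⟩
  · rw [s1]; exact (a0.mul_left _).add (a1.mul_left _)
  · rw [s2]; exact ((a0.mul_left _).add (a1.mul_left _)).add (a2.mul_left _)
  · rw [s1, s2, ((a0.mul_left _).add (a1.mul_left _)).tsum_add (a2.mul_left _),
      (a0.mul_left _).tsum_add (a1.mul_left _), (a0.mul_left _).tsum_add (a1.mul_left _)]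
    simp only [tsum_mul_left]
    have h := Jet.mul hg hf.jet
    convert h using 1 <;> ring

theorem JetSum.congr {f g : ℂ → ℂ} {t l c t' l' c' : ℕ → ℂ} (hf : JetSum f t l c)
    (h : ∀ᶠ u in 𝓝[≠] 0, g u = f u) (ht : ∀ k, t' k = t k) (hl : ∀ k, l' k = l k)
    (hc : ∀ k, c' k = c k) : JetSum g t' l' c' := by
  obtain rfl : t' = t := funext ht
  obtain rfl : l' = l := funext hl
  obtain rfl : c' = c := funext hc
  exact ⟨hf.1, hf.2, hf.3, hf.4.congr h⟩

theorem qPoch_zero (a q : ℂ) : qPoch a q 0 = 1 := by simp [qPoch]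

theorem qPoch_succ (a q : ℂ) (k : ℕ) : qPoch a q (k + 1) = qPoch a q k * (1 - a * q ^ k) := by
  simp [qPoch, Finset.prod_range_succ]

theorem qPoch_succ' (a q : ℂ) (k : ℕ) : qPoch a q (k + 1) = (1 - a) * qPoch (a * q) q k := by
  simp only [qPoch, Finset.prod_range_succ', pow_zero, mul_one]
  rw [mul_comm]
  congr 1
  refine Finset.prod_congr rfl fun i _ => ?_
  ring

theorem summable_norm_mul_pow (a : ℂ) {q : ℂ} (hq : ‖q‖ < 1) :
    Summable fun i : ℕ => ‖-(a * q ^ i)‖ := by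
  simpa using (summable_geometric_of_lt_one (norm_nonneg q) hq).mul_left ‖a‖

theorem multipliable_one_sub_mul_pow (a : ℂ) {q : ℂ} (hq : ‖q‖ < 1) :
    Multipliable fun i : ℕ => 1 - a * q ^ i := by
  simpa [sub_eq_add_neg] using multipliable_one_add_of_summable (summable_norm_mul_pow a hq)

theorem tendsto_qPoch (a : ℂ) {q : ℂ} (hq : ‖q‖ < 1) :
    Tendsto (qPoch a q) atTop (𝓝 (qPochInf a q)) :=
  (multipliable_one_sub_mul_pow a hq).hasProd.tendsto_prod_nat

theorem qPochInf_ne_zero {a q : ℂ} (hq : ‖q‖ < 1) (h : ∀ i : ℕ, 1 - a * q ^ i ≠ 0) :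
    qPochInf a q ≠ 0 := by
  have := tprod_one_add_ne_zero_of_summable (f := fun i : ℕ => -(a * q ^ i))
    (fun i => by simpa [sub_eq_add_neg] using h i) (summable_norm_mul_pow a hq)
  simpa [qPochInf, sub_eq_add_neg] using this

theorem qPochInf_eq_mul (a : ℂ) {q : ℂ} (hq : ‖q‖ < 1) :
    qPochInf a q = (1 - a) * qPochInf (a * q) q := by
  refine tendsto_nhds_unique ((tendsto_add_atTop_iff_nat 1).2 (tendsto_qPoch a hq)) ?_
  simp only [qPoch_succ']
  exact (tendsto_qPoch (a * q) hq).const_mul _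

theorem norm_qPoch_le (a : ℂ) {q : ℂ} (hq : ‖q‖ < 1) (k : ℕ) :
    ‖qPoch a q k‖ ≤ Real.exp (∑' i : ℕ, ‖a‖ * ‖q‖ ^ i) := by
  rw [qPoch, norm_prod]
  have h1 : ∀ i ∈ Finset.range k, ‖1 - a * q ^ i‖ ≤ 1 + ‖a‖ * ‖q‖ ^ i := fun i _ =>
    (norm_sub_le _ _).trans (by simp)
  refine (Finset.prod_le_prod (fun i _ => norm_nonneg _) h1).trans ?_
  refine (Real.prod_one_add_le_exp_sum _ fun i => by positivity).trans ?_
  exact Real.exp_le_exp.2 (((summable_geometric_of_lt_one (norm_nonneg q) hq).mul_left ‖a‖).sum_le_tsum _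
    fun i _ => by positivity)

theorem summable_mul_pow_div (a : ℂ) {q : ℂ} (hq : ‖q‖ < 1) (n : ℕ) :
    Summable fun i : ℕ => a * q ^ i / (1 - a * q ^ i) ^ n := by
  simp only [div_eq_mul_one_div (_ * _ ^ _)]
  have ht : Tendsto (fun i : ℕ => 1 - a * q ^ i) atTop (𝓝 1) := by
    simpa using ((tendsto_pow_atTop_nhds_zero_of_norm_lt_one hq).const_mul a).const_sub 1
  refine Summable.mul_tendsto_const (c := 1 / 1 ^ n)
    (by simpa using (summable_norm_mul_pow a hq)) ?_
  rw [Nat.cofinite_eq_atTop]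
  exact tendsto_const_nhds.div (ht.pow n) (by simp)

theorem LJet.qPoch_exp {a q : ℂ} (k : ℕ) (h : ∀ i < k, 1 - a * q ^ i ≠ 0) :
    LJet (fun u => qPoch (a * Complex.exp u) q k) (qPoch a q k)
      (∑ i ∈ Finset.range k, -(a * q ^ i / (1 - a * q ^ i)))
      (∑ i ∈ Finset.range k, -(a * q ^ i / (1 - a * q ^ i) ^ 2) / 2) := by
  refine (LJet.prod (Finset.range k) fun i hi =>
    LJet.one_sub_mul_exp (h i (Finset.mem_range.1 hi))).congr (Eventually.of_forall fun u => ?_)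
  refine Finset.prod_congr rfl fun i _ => ?_
  ring

theorem LJet.qPochInf_exp {a q : ℂ} (hq : ‖q‖ < 1) (h : ∀ i : ℕ, 1 - a * q ^ i ≠ 0) :
    LJet (fun u => qPochInf (a * Complex.exp u) q) (qPochInf a q)
      (-∑' i : ℕ, a * q ^ i / (1 - a * q ^ i))
      (-(∑' i : ℕ, a * q ^ i / (1 - a * q ^ i) ^ 2) / 2) := by
  have t0 := tendsto_qPoch a hq
  have t1 := (summable_mul_pow_div a hq 1).hasSum.tendsto_sum_nat.neg
  have t2 := ((summable_mul_pow_div a hq 2).hasSum.tendsto_sum_nat.neg).div_const 2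
  simp only [pow_one, ← Finset.sum_neg_distrib, Finset.sum_div] at t1 t2
  refine Jet.of_tendsto (ρ := 1) (M := Real.exp (∑' i : ℕ, ‖a‖ * Real.exp 1 * ‖q‖ ^ i)) one_pos
    (F := fun k u => qPoch (a * Complex.exp u) q k) ?_ ?_
    (fun k => LJet.qPoch_exp k fun i _ => h i) (fun u _ => tendsto_qPoch _ hq)
    t0 (t0.mul t1) (t0.mul (((t1.pow 2).div_const 2).add t2))
  · intro k
    simp only [qPoch]
    fun_prop
  · intro k u hu
    refine (norm_qPoch_le _ hq k).trans (Real.exp_le_exp.2 ?_)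
    refine Summable.tsum_le_tsum (fun i => ?_)
      ((summable_geometric_of_lt_one (norm_nonneg q) hq).mul_left _)
      ((summable_geometric_of_lt_one (norm_nonneg q) hq).mul_left _)
    have : ‖Complex.exp u‖ ≤ Real.exp 1 := by
      rw [Complex.norm_exp, Real.exp_le_exp]
      exact (Complex.re_le_norm u).trans (by simpa using (Metric.mem_ball.1 hu).le)
    rw [norm_mul]
    gcongr

theorem one_sub_pow_ne_zero {q : ℂ} (hq : ‖q‖ ≠ 1) {m : ℕ} (hm : m ≠ 0) : 1 - q ^ m ≠ 0 := by
  intro h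
  have h1 : ‖q‖ ^ m = 1 := by rw [← norm_pow, ← sub_eq_zero.1 h, norm_one]
  exact hq ((pow_eq_one_iff_of_nonneg (norm_nonneg q) hm).1 h1)

theorem E_one_of_norm_lt_one {q : ℂ} (hq : ‖q‖ < 1) :
    E 1 q = -1 / 4 + ∑' i : ℕ, q * q ^ i / (1 - q * q ^ i) := by
  simp only [E, hq, if_true, Nat.cast_one, sub_self, riemannZeta_zero, pow_succ']
  norm_num

theorem riemannZeta_neg_one : riemannZeta (-1) = -1 / 12 := by
  have := riemannZeta_neg_nat_eq_bernoulli 1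
  rw [bernoulli_eq_bernoulli'_of_ne_one (by norm_num), bernoulli'_two] at this
  norm_num at this ⊢
  rw [this]

/-- The two forms of the Lambert series of `σ₁`. -/
theorem tsum_lambert {q : ℂ} (hq : ‖q‖ < 1) :
    ∑' m : ℕ, ((m + 1 : ℕ) : ℂ) * (q ^ (m + 1) / (1 - q ^ (m + 1))) =
      ∑' i : ℕ, q ^ (i + 1) / (1 - q ^ (i + 1)) ^ 2 := by
  have hp : ∀ i : ℕ, ‖q ^ (i + 1)‖ < 1 := fun i => by
    rw [norm_pow]; exact pow_lt_one₀ (norm_nonneg _) hq (by simp)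
  have h1 : ∀ m : ℕ, ((m + 1 : ℕ) : ℂ) * (q ^ (m + 1) / (1 - q ^ (m + 1))) =
      ∑' i : ℕ, ((m + 1 : ℕ) : ℂ) * q ^ ((i + 1) * (m + 1)) := fun m => by
    rw [tsum_mul_left, div_eq_mul_inv, ← tsum_geometric_of_norm_lt_one (hp m), ← tsum_mul_left]
    congr 2; ext i; ring
  have h2 : ∀ i : ℕ, q ^ (i + 1) / (1 - q ^ (i + 1)) ^ 2 =
      ∑' m : ℕ, ((m + 1 : ℕ) : ℂ) * q ^ ((i + 1) * (m + 1)) := fun i => by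
    have := hasSum_coe_mul_geometric_of_norm_lt_one (hp i)
    rw [← this.tsum_eq, this.summable.tsum_eq_zero_add]
    simp [← pow_mul]
  have hs : Summable (Function.uncurry fun i m : ℕ =>
      ((m + 1 : ℕ) : ℂ) * q ^ ((i + 1) * (m + 1))) := by
    have := (Equiv.prodCongr Equiv.pnatEquivNat.symm Equiv.pnatEquivNat.symm).summable_iff.2
      (summable_prod_mul_pow 1 hq)
    refine this.congr fun x => ?_
    simp [Function.uncurry, Equiv.pnatEquivNat]
  simp_rw [h1, h2]
  exact hs.tsum_comm

theorem E_two_of_norm_lt_one {q : ℂ} (hq : ‖q‖ < 1) :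
    E 2 q = -1 / 24 + ∑' i : ℕ, q * q ^ i / (1 - q * q ^ i) ^ 2 := by
  have := tsum_lambert hq
  have hz : riemannZeta (1 - (2 : ℕ)) = -1 / 12 := by
    rw [← riemannZeta_neg_one]; norm_num
  simp only [E, hq, if_true, hz, show 2 - 1 = 1 from rfl, pow_one]
  rw [this]
  simp only [pow_succ']
  norm_num

/-- The function `(q x; q)_∞` for `|q| < 1` and `1 / (x; q⁻¹)_∞` for `|q| > 1`. -/
def P (x q : ℂ) : ℂ := if ‖q‖ < 1 then qPochInf (q * x) q else (qPochInf x q⁻¹)⁻¹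

theorem norm_inv_lt_one {q : ℂ} (hq1 : ‖q‖ ≠ 1) (h : ¬‖q‖ < 1) : ‖q⁻¹‖ < 1 := by
  rw [norm_inv]
  exact inv_lt_one_of_one_lt₀ (lt_of_le_of_ne (not_lt.1 h) (Ne.symm hq1))

theorem P_eq_mul {x q : ℂ} (hq0 : q ≠ 0) (hq1 : ‖q‖ ≠ 1) (hx : 1 - q * x ≠ 0) :
    P x q = (1 - q * x) * P (q * x) q := by
  unfold P
  split_ifs with h
  · rw [qPochInf_eq_mul _ h]
    ring_nf
  · rw [qPochInf_eq_mul (q * x) (norm_inv_lt_one hq1 h), mul_inv, ← mul_assoc,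
      mul_inv_cancel₀ hx, one_mul]
    congr 2
    field_simp

theorem P_pow_mul {x q : ℂ} (hq0 : q ≠ 0) (hq1 : ‖q‖ ≠ 1) (hx : ∀ m : ℤ, q ^ m * x ≠ 1) (k : ℕ) :
    P (q ^ k * x) q = P x q / qPoch (q * x) q k := by
  induction k with
  | zero => simp [qPoch_zero]
  | succ k ih =>
    have h1 : 1 - q * (q ^ k * x) ≠ 0 := by
      have := hx (k + 1 : ℕ)
      rw [zpow_natCast] at this
      rw [← mul_assoc, ← pow_succ', sub_ne_zero]
      exact this.symm
    rw [P_eq_mul hq0 hq1 h1, ← mul_assoc, ← pow_succ'] at ih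
    rw [qPoch_succ, ← div_div, ← ih, eq_div_iff (by convert h1 using 1; ring)]
    ring

theorem P_inv_pow_mul {x q : ℂ} (hq0 : q ≠ 0) (hq1 : ‖q‖ ≠ 1) (hx : ∀ m : ℤ, q ^ m * x ≠ 1)
    (k : ℕ) : P (q⁻¹ ^ k * x) q = P x q * qPoch x q⁻¹ k := by
  induction k with
  | zero => simp [qPoch_zero]
  | succ k ih =>
    have h0 : q * (q⁻¹ ^ (k + 1) * x) = q⁻¹ ^ k * x := by
      rw [pow_succ]; field_simp
    have h1 : 1 - q * (q⁻¹ ^ (k + 1) * x) ≠ 0 := by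
      have := hx (-(k : ℤ))
      rw [zpow_neg, zpow_natCast, ← inv_pow] at this
      rw [h0, sub_ne_zero]
      exact this.symm
    rw [P_eq_mul hq0 hq1 h1, h0, ih, qPoch_succ]
    ring

theorem G_eq_tsum {x y z q : ℂ} (hq0 : q ≠ 0) (hq1 : ‖q‖ ≠ 1) (hx : ∀ m : ℤ, q ^ m * x ≠ 1)
    (hy : ∀ m : ℤ, q ^ m * y ≠ 1) :
    G x y z q = ∑' k : ℕ, z ^ k / qPoch q⁻¹ q⁻¹ k * P (q ^ k * x) q * P (q ^ k * y) q := by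
  have : G x y z q = P x q * P y q *
      ∑' k : ℕ, z ^ k / (qPoch q⁻¹ q⁻¹ k * qPoch (q * x) q k * qPoch (q * y) q k) := by
    unfold G P
    split_ifs
    · rfl
    · rw [one_div, mul_inv]
  rw [this, ← tsum_mul_left]
  refine tsum_congr fun k => ?_
  rw [P_pow_mul hq0 hq1 hx, P_pow_mul hq0 hq1 hy]
  simp only [div_eq_mul_inv, mul_inv]
  ring

theorem theta_inv_right {s : ℂ} (hs0 : s ≠ 0) (hs1 : ‖s‖ ≠ 1) (x : ℂ) :
    theta x s⁻¹ = (theta x s)⁻¹ := by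
  unfold theta
  rcases lt_or_gt_of_ne hs1 with h | h
  · have h' : ¬ ‖s⁻¹‖ < 1 := by
      rw [norm_inv, not_lt]
      exact (one_le_inv₀ (norm_pos_iff.2 hs0)).2 h.le
    rw [if_neg h', if_pos h, inv_inv]
  · have h' : ‖s⁻¹‖ < 1 := by rw [norm_inv]; exact inv_lt_one_of_one_lt₀ h
    rw [if_pos h', if_neg (not_lt.2 h.le), inv_inv]

theorem theta_inv_left (x s : ℂ) : theta x⁻¹ s = theta x s := by
  unfold theta
  rw [inv_inv]
  split_ifs
  · ring
  · rw [mul_comm]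

theorem norm_sq_lt_one {s : ℂ} : ‖s ^ 2‖ < 1 ↔ ‖s‖ < 1 := by
  rw [norm_pow]
  exact pow_lt_one_iff_of_nonneg (norm_nonneg s) two_ne_zero

theorem norm_sq_ne_one {s : ℂ} (hs1 : ‖s‖ ≠ 1) : ‖s ^ 2‖ ≠ 1 := by
  rw [norm_pow]
  exact fun h => hs1 ((pow_eq_one_iff_of_nonneg (norm_nonneg s) two_ne_zero).1 h)

theorem theta_neg_mul {x s : ℂ} (hs0 : s ≠ 0) (hs1 : ‖s‖ ≠ 1) (hx0 : x ≠ 0) (hx1 : x ≠ 1) :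
    theta (-s * x) s = (1 - x⁻¹) * (P x (s ^ 2) * P x⁻¹ (s ^ 2)) := by
  unfold theta P
  simp only [norm_sq_lt_one]
  split_ifs with h
  · have e1 : -s * (-s * x) = s ^ 2 * x := by ring
    have e2 : -s * (-s * x)⁻¹ = x⁻¹ := by field_simp
    rw [e1, e2, qPochInf_eq_mul x⁻¹ (norm_sq_lt_one.2 h)]
    ring_nf
  · have e1 : -s⁻¹ * (-s * x) = x := by field_simp
    have e2 : -s⁻¹ * (-s * x)⁻¹ = x⁻¹ * (s ^ 2)⁻¹ := by field_simp
    have hp := norm_inv_lt_one (norm_sq_ne_one hs1) (mt norm_sq_lt_one.1 h)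
    have hx : 1 - x⁻¹ ≠ 0 := by
      rw [sub_ne_zero]; intro h; exact hx1 (inv_eq_one.1 h.symm)
    rw [e1, e2, inv_pow, qPochInf_eq_mul x⁻¹ hp, mul_inv, mul_inv]
    field_simp

theorem theta_sq_mul_of_norm_lt_one {x s : ℂ} (hs0 : s ≠ 0) (h : ‖s‖ < 1) (hx0 : x ≠ 0) :
    theta (s ^ 2 * x) s = s⁻¹ * x⁻¹ * theta x s := by
  have hq := norm_sq_lt_one.2 h
  simp only [theta, if_pos h]
  have e1 : -s * (s ^ 2 * x)⁻¹ = -s⁻¹ * x⁻¹ := by field_simp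
  have e2 : -s⁻¹ * x⁻¹ * s ^ 2 = -s * x⁻¹ := by field_simp
  rw [qPochInf_eq_mul (-s * x) hq, e1, qPochInf_eq_mul (-s⁻¹ * x⁻¹) hq, e2,
    show -s * x * s ^ 2 = -s * (s ^ 2 * x) by ring]
  field_simp
  ring

theorem theta_sq_mul {x s : ℂ} (hs0 : s ≠ 0) (hs1 : ‖s‖ ≠ 1) (hx0 : x ≠ 0) :
    theta (s ^ 2 * x) s = s⁻¹ * x⁻¹ * theta x s := by
  rcases lt_or_gt_of_ne hs1 with h | h
  · exact theta_sq_mul_of_norm_lt_one hs0 h hx0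
  · have h' : ‖s⁻¹‖ < 1 := by rw [norm_inv]; exact inv_lt_one_of_one_lt₀ h
    have hr := theta_sq_mul_of_norm_lt_one (x := s ^ 2 * x) (inv_ne_zero hs0) h' (by positivity)
    rw [show s⁻¹ ^ 2 * (s ^ 2 * x) = x by field_simp, theta_inv_right hs0 hs1, theta_inv_right hs0 hs1] at hr
    rw [← inv_inv (theta x s), hr]
    simp only [mul_inv, inv_inv]
    field_simp

theorem theta_zpow_mul {x s : ℂ} (hs0 : s ≠ 0) (hs1 : ‖s‖ ≠ 1) (hx0 : x ≠ 0) (n : ℤ) :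
    theta ((s ^ 2) ^ n * x) s = s ^ (-n ^ 2) * x ^ (-n) * theta x s := by
  have step : ∀ m : ℤ, theta ((s ^ 2) ^ (m + 1) * x) s =
      s⁻¹ * ((s ^ 2) ^ m)⁻¹ * x⁻¹ * theta ((s ^ 2) ^ m * x) s := fun m => by
    rw [zpow_add_one₀ (by positivity), mul_comm _ (s ^ 2), mul_assoc,
      theta_sq_mul hs0 hs1 (mul_ne_zero (zpow_ne_zero _ (by positivity)) hx0)]
    simp only [mul_inv]; ring
  have hc : ∀ m : ℤ, s ^ (-(m + 1) ^ 2) * x ^ (-(m + 1)) =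
      s⁻¹ * ((s ^ 2) ^ m)⁻¹ * x⁻¹ * (s ^ (-m ^ 2) * x ^ (-m)) := fun m => by
    rw [show -(m + 1) ^ 2 = -m ^ 2 + (-(2 * m) + -1) by ring, neg_add, zpow_add₀ hs0,
      zpow_add₀ hs0, zpow_add₀ hx0, zpow_neg_one, zpow_neg_one, zpow_neg s (2 * m), zpow_mul]
    norm_cast
    ring
  induction n using Int.induction_on with
  | zero => simp
  | succ m ih => rw [step, ih, hc]; ring
  | pred m ih =>
    have h1 := step (-(m : ℤ) - 1)
    have h2 := hc (-(m : ℤ) - 1)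
    rw [sub_add_cancel] at h1 h2
    rw [ih, h2] at h1
    have h3 : s⁻¹ * ((s ^ 2) ^ (-(m : ℤ) - 1))⁻¹ * x⁻¹ ≠ 0 := by
      have := zpow_ne_zero (-(m : ℤ) - 1) (pow_ne_zero 2 hs0)
      positivity
    apply mul_left_cancel₀ h3
    rw [← h1]; ring

theorem one_sub_neg_mul_pow_ne_zero {s : ℂ} (h : ‖s‖ < 1) (i : ℕ) :
    1 - -s * (s ^ 2) ^ i ≠ 0 := by
  intro h0
  have h1 : ‖-s * (s ^ 2) ^ i‖ = 1 := by rw [← sub_eq_zero.1 h0, norm_one]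
  have h2 : ‖s‖ ^ (2 * i + 1) < 1 := pow_lt_one₀ (norm_nonneg s) h (by simp)
  rw [norm_mul, norm_neg, norm_pow, norm_pow, ← pow_mul, mul_comm, ← pow_succ] at h1
  exact h2.ne h1

theorem theta_one_of_norm_lt_one {s : ℂ} (h : ‖s‖ < 1) :
    theta 1 s = qPochInf (-s) (s ^ 2) ^ 2 := by
  simp [theta, h, sq]

theorem exists_LJet_theta_exp {s : ℂ} (hs0 : s ≠ 0) (hs1 : ‖s‖ ≠ 1) :
    theta 1 s ≠ 0 ∧ ∃ c, LJet (fun u => theta (Complex.exp u) s) (theta 1 s) 0 c := by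
  have key : ∀ s : ℂ, ‖s‖ < 1 →
      theta 1 s ≠ 0 ∧ ∃ c, LJet (fun u => theta (Complex.exp u) s) (theta 1 s) 0 c := by
    intro s h
    have hq := norm_sq_lt_one.2 h
    have h1 := LJet.qPochInf_exp hq (one_sub_neg_mul_pow_ne_zero h)
    have h2 := h1.mul (h1.scale (l := -1) (by norm_num))
    rw [theta_one_of_norm_lt_one h, sq]
    have h3 := qPochInf_ne_zero hq (one_sub_neg_mul_pow_ne_zero h)
    rw [show ∀ z : ℂ, z + -1 * z = 0 by intro z; ring] at h2
    refine ⟨mul_ne_zero h3 h3, _, h2.congr (Eventually.of_forall fun u => ?_)⟩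
    simp [theta, h, Complex.exp_neg]
  rcases lt_or_gt_of_ne hs1 with h | h
  · exact key s h
  · have h' : ‖s⁻¹‖ < 1 := by rw [norm_inv]; exact inv_lt_one_of_one_lt₀ h
    obtain ⟨h0, c, hc⟩ := key _ h'
    simp only [theta_inv_right hs0 hs1] at h0 hc
    refine ⟨fun h1 => h0 (by rw [h1, inv_zero]), -c, ?_⟩
    simpa using hc.inv h0

/-- The leading behaviour of `P (e^u) q`. -/
def kap (q u : ℂ) : ℂ := if ‖q‖ < 1 then qPochInf q q else -(qPochInf q⁻¹ q⁻¹ * u)⁻¹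

theorem one_sub_mul_pow_ne_zero {q : ℂ} (hq : ‖q‖ < 1) (i : ℕ) : 1 - q * q ^ i ≠ 0 := by
  rw [← pow_succ']
  exact one_sub_pow_ne_zero hq.ne (by simp)

theorem qPochInf_self_ne_zero {q : ℂ} (hq : ‖q‖ < 1) : qPochInf q q ≠ 0 :=
  qPochInf_ne_zero hq (one_sub_mul_pow_ne_zero hq)

theorem kap_ne_zero {q u : ℂ} (hq1 : ‖q‖ ≠ 1) (hu : u ≠ 0) : kap q u ≠ 0 := by
  unfold kap
  split_ifs with h
  · exact qPochInf_self_ne_zero h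
  · exact neg_ne_zero.2 (inv_ne_zero (mul_ne_zero (qPochInf_self_ne_zero (norm_inv_lt_one hq1 h)) hu))

theorem LJet_P {q : ℂ} (hq1 : ‖q‖ ≠ 1) :
    LJet (fun u => P (Complex.exp u) q / kap q u) 1 (-(E 1 q + 1 / 4))
      (-(E 2 q + 1 / 24) / 2) := by
  rcases lt_or_gt_of_ne hq1 with h | h
  · have h1 := (LJet.qPochInf_exp h (one_sub_mul_pow_ne_zero h)).mul
      (LJet.const (qPochInf q q)⁻¹)
    rw [mul_inv_cancel₀ (qPochInf_self_ne_zero h)] at h1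
    rw [E_one_of_norm_lt_one h, E_two_of_norm_lt_one h]
    convert h1.congr (g := fun u => P (Complex.exp u) q / kap q u)
      (Eventually.of_forall fun u => ?_) using 1
    · ring
    · ring
    · simp [P, kap, h, div_eq_mul_inv]
  · have h' : ¬‖q‖ < 1 := not_lt.2 h.le
    have hp := norm_inv_lt_one hq1 h'
    have e : ∀ l, E l q = -E l q⁻¹ := fun l => by
      simp only [E, if_neg h', if_pos hp]
    have h1 := (LJet.qPochInf_exp hp (one_sub_mul_pow_ne_zero hp)).mul LJet.exp_sub_one_div
    have hne := qPochInf_self_ne_zero hp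
    have h2 := (h1.inv (by simpa using hne)).mul (LJet.const (qPochInf q⁻¹ q⁻¹))
    rw [mul_one, inv_mul_cancel₀ hne] at h2
    rw [e, e, E_one_of_norm_lt_one hp, E_two_of_norm_lt_one hp]
    convert h2.congr (g := fun u => P (Complex.exp u) q / kap q u) ?_ using 1
    · ring
    · ring
    · filter_upwards [self_mem_nhdsWithin] with u hu
      have hu' : u ≠ 0 := hu
      simp only [P, kap, h', if_false]
      rw [qPochInf_eq_mul (Complex.exp u) hp, mul_comm (Complex.exp u) q⁻¹, div_neg, div_inv_eq_mul,
        mul_inv, mul_inv, inv_div, ← neg_sub (Complex.exp u) 1, inv_neg]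
      ring

theorem eventually_generic {q : ℂ} (hq0 : q ≠ 0) (hq1 : ‖q‖ ≠ 1) :
    ∀ᶠ u in 𝓝[≠] 0, ∀ m : ℤ, q ^ m * Complex.exp u ≠ 1 := by
  have hlog : Real.log ‖q‖ ≠ 0 := Real.log_ne_zero_of_pos_of_ne_one (norm_pos_iff.2 hq0) hq1
  filter_upwards [Jet.exp_sub_one_div.tendsto.eventually_ne one_ne_zero,
    eventually_mem_ball (abs_pos.2 hlog)] with u h1 h2 m hm
  have h3 := congrArg (fun z => Real.log ‖z‖) hm
  simp only [norm_mul, norm_zpow, Complex.norm_exp, norm_one, Real.log_one] at h3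
  rw [Real.log_mul (zpow_ne_zero _ (norm_ne_zero_iff.2 hq0)) (Real.exp_ne_zero _), Real.log_zpow,
    Real.log_exp] at h3
  have hm0 : m = 0 := by
    by_contra hne
    have h4 : |(m : ℝ) * Real.log ‖q‖| = |u.re| := by
      rw [eq_neg_of_add_eq_zero_left h3, abs_neg]
    have h5 : (1 : ℝ) ≤ |(m : ℝ)| := by exact_mod_cast Int.one_le_abs hne
    have h6 := Complex.abs_re_le_norm u
    have h7 : ‖u‖ < |Real.log ‖q‖| := by simpa using h2
    rw [abs_mul] at h4
    nlinarith [abs_nonneg (Real.log ‖q‖)]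
  subst hm0
  apply h1
  simp only [zpow_zero, one_mul] at hm
  simp [hm]

/-- Lower bounds for the factors of the Pochhammer symbols near `u = 0`. -/
theorem exists_factor_bound {q : ℂ} (hq0 : q ≠ 0) (hq1 : ‖q‖ ≠ 1) :
    ∃ ρ : ℝ, 0 < ρ ∧ ρ ≤ 1 ∧ ∃ d : ℕ → ℝ, (∀ m, 0 < d m) ∧
      (∀ m : ℕ, ∀ v : ℂ, ‖v‖ ≤ 2 * ρ → d m ≤ ‖1 - q ^ (m + 1) * Complex.exp v‖) ∧
      ∀ l A B : ℕ, Tendsto (fun k => ‖1 - q⁻¹ ^ (k + l + 1)‖ * (d (k + A) * d (k + B)))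
        atTop atTop := by
  have hqpos := norm_pos_iff.2 hq0
  have shift : ∀ l, Tendsto (fun k : ℕ => k + l + 1) atTop atTop := fun l =>
    tendsto_atTop_mono (fun k => by simp only [id]; omega) tendsto_id
  have shift' : ∀ l, Tendsto (fun k : ℕ => k + l) atTop atTop := fun l =>
    tendsto_atTop_mono (fun k => by simp only [id]; omega) tendsto_id
  have hexp : ∀ {ρ : ℝ} {v : ℂ}, ‖v‖ ≤ 2 * ρ →
      Real.exp (-(2 * ρ)) ≤ ‖Complex.exp v‖ ∧ ‖Complex.exp v‖ ≤ Real.exp (2 * ρ) := by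
    intro ρ v hv
    have := abs_le.1 ((Complex.abs_re_le_norm v).trans hv)
    rw [Complex.norm_exp, Real.exp_le_exp, Real.exp_le_exp]
    exact this
  rcases lt_or_gt_of_ne hq1 with h | h
  · have hl : Real.log ‖q‖ < 0 := Real.log_neg hqpos h
    obtain ⟨ρ, hρ, hρ'⟩ := exists_between (lt_min one_pos (by linarith : 0 < -Real.log ‖q‖ / 2))
    have hR : ‖q‖ * Real.exp (2 * ρ) < 1 := by
      have h1 := hρ'.trans_le (min_le_right _ _)
      nth_rw 1 [← Real.exp_log hqpos]
      rw [← Real.exp_add, Real.exp_lt_one_iff]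
      linarith
    refine ⟨ρ, hρ, (hρ'.trans_le (min_le_left _ _)).le,
      fun m => 1 - ‖q‖ ^ (m + 1) * Real.exp (2 * ρ), fun m => ?_, fun m v hv => ?_, fun l A B => ?_⟩
    · have : ‖q‖ ^ (m + 1) ≤ ‖q‖ := pow_le_of_le_one (norm_nonneg _) h.le (by simp)
      nlinarith [Real.exp_pos (2 * ρ)]
    · have h1 := norm_sub_norm_le (1 : ℂ) (q ^ (m + 1) * Complex.exp v)
      rw [norm_one, norm_mul, norm_pow] at h1
      refine le_trans ?_ h1
      exact sub_le_sub_left (mul_le_mul_of_nonneg_left (hexp hv).2 (by positivity)) 1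
    · have h1 : ∀ A, Tendsto (fun k : ℕ => 1 - ‖q‖ ^ (k + A + 1) * Real.exp (2 * ρ)) atTop (𝓝 1) :=
        fun A => by
        have := (((tendsto_pow_atTop_nhds_zero_of_lt_one (norm_nonneg q) h).comp
          (shift A)).mul_const (Real.exp (2 * ρ))).const_sub 1
        simpa using this
      have h2 : Tendsto (fun k : ℕ => ‖1 - q⁻¹ ^ (k + l + 1)‖) atTop atTop := by
        have h3 : Tendsto (fun k : ℕ => ‖q⁻¹‖ ^ (k + l + 1) - 1) atTop atTop :=
          tendsto_atTop_add_const_right _ _ ((tendsto_pow_atTop_atTop_of_one_lt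
            (by rw [norm_inv]; exact (one_lt_inv₀ hqpos).2 h)).comp (shift l))
        refine tendsto_atTop_mono (fun k => ?_) h3
        have := norm_sub_norm_le (q⁻¹ ^ (k + l + 1)) 1
        rwa [norm_one, norm_pow, norm_sub_rev] at this
      exact h2.atTop_mul_pos one_pos (by simpa using (h1 A).mul (h1 B))
  · have hl : 0 < Real.log ‖q‖ := Real.log_pos h
    obtain ⟨ρ, hρ, hρ'⟩ := exists_between (lt_min one_pos (by linarith : 0 < Real.log ‖q‖ / 2))
    have hR : 1 < ‖q‖ * Real.exp (-(2 * ρ)) := by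
      have h1 := hρ'.trans_le (min_le_right _ _)
      nth_rw 1 [← Real.exp_log hqpos]
      rw [← Real.exp_add, Real.one_lt_exp_iff]
      linarith
    refine ⟨ρ, hρ, (hρ'.trans_le (min_le_left _ _)).le,
      fun m => ‖q‖ ^ (m + 1) * Real.exp (-(2 * ρ)) - 1, fun m => ?_, fun m v hv => ?_,
      fun l A B => ?_⟩
    · have : ‖q‖ ≤ ‖q‖ ^ (m + 1) := le_self_pow₀ h.le (by simp)
      nlinarith [Real.exp_pos (-(2 * ρ))]
    · have h1 := norm_sub_norm_le (q ^ (m + 1) * Complex.exp v) 1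
      rw [norm_one, norm_mul, norm_pow, norm_sub_rev] at h1
      refine le_trans ?_ h1
      exact sub_le_sub_right (mul_le_mul_of_nonneg_left (hexp hv).1 (by positivity)) 1
    · have h1 : ∀ A, Tendsto (fun k : ℕ => ‖q‖ ^ (k + A + 1) * Real.exp (-(2 * ρ)) - 1)
          atTop atTop := fun A =>
        tendsto_atTop_add_const_right _ _ (((tendsto_pow_atTop_atTop_of_one_lt h).comp
          (shift A)).atTop_mul_const (Real.exp_pos _))
      have h2 : Tendsto (fun k : ℕ => ‖1 - q⁻¹ ^ (k + l + 1)‖) atTop (𝓝 1) := by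
        have := (((tendsto_pow_atTop_nhds_zero_of_norm_lt_one
          (norm_inv_lt_one hq1 (not_lt.2 h.le))).comp (shift l)).const_sub 1).norm
        simpa using this
      exact h2.pos_mul_atTop one_pos ((h1 A).atTop_mul_atTop₀ (h1 B))

/-- The summands of the series `G` near `u = 0`. -/
def gterm (q w c a b : ℂ) (l A B k : ℕ) (u : ℂ) : ℂ :=
  w ^ k * Complex.exp (c * k * u) / (qPoch q⁻¹ q⁻¹ (k + l) *
    (qPoch (q * Complex.exp (a * u)) q (k + A) * qPoch (q * Complex.exp (b * u)) q (k + B)))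

theorem qPoch_self_ne_zero {q : ℂ} (hq1 : ‖q‖ ≠ 1) (k : ℕ) : qPoch q q k ≠ 0 := by
  refine Finset.prod_ne_zero_iff.2 fun i _ => ?_
  rw [← pow_succ']
  exact one_sub_pow_ne_zero hq1 (by simp)

theorem norm_inv_ne_one {q : ℂ} (hq1 : ‖q‖ ≠ 1) : ‖q⁻¹‖ ≠ 1 := by
  rw [norm_inv]
  exact fun h => hq1 (inv_eq_one.1 h)

theorem sum_range_eq_H (q : ℂ) (k : ℕ) : ∑ i ∈ Finset.range k, q * q ^ i / (1 - q * q ^ i) = H k q := by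
  simp only [H, ← pow_succ', Finset.range_eq_Ico,
    Finset.sum_Ico_add' (fun j => q ^ j / (1 - q ^ j)) 0 k 1]
  rfl

theorem sum_range_eq_H2 (q : ℂ) (k : ℕ) :
    ∑ i ∈ Finset.range k, q * q ^ i / (1 - q * q ^ i) ^ 2 = H2 k q := by
  simp only [H2, ← pow_succ', Finset.range_eq_Ico,
    Finset.sum_Ico_add' (fun j => q ^ j / (1 - q ^ j) ^ 2) 0 k 1]
  rfl

theorem LJet.qPoch_self {q : ℂ} (hq1 : ‖q‖ ≠ 1) (k : ℕ) {a : ℂ} (ha : a ≠ 0) :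
    LJet (fun u => qPoch (q * Complex.exp (a * u)) q k) (qPoch q q k)
      (-(a * H k q)) (-(a ^ 2 * H2 k q) / 2) := by
  have h := (LJet.qPoch_exp (a := q) (q := q) k fun i _ => by
    rw [← pow_succ']; exact one_sub_pow_ne_zero hq1 (by simp)).scale ha
  rw [← Finset.sum_div, Finset.sum_neg_distrib, Finset.sum_neg_distrib, sum_range_eq_H,
    sum_range_eq_H2] at h
  convert h using 1 <;> ring

theorem LJet.gterm {q w c a b : ℂ} (hq1 : ‖q‖ ≠ 1) (ha : a ≠ 0) (hb : b ≠ 0) (l A B k : ℕ) :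
    LJet (gterm q w c a b l A B k)
      (w ^ k / (qPoch q⁻¹ q⁻¹ (k + l) * (qPoch q q (k + A) * qPoch q q (k + B))))
      (c * k + a * H (k + A) q + b * H (k + B) q)
      ((a ^ 2 * H2 (k + A) q + b ^ 2 * H2 (k + B) q) / 2) := by
  have hd := (LJet.qPoch_self hq1 (k + A) ha).mul (LJet.qPoch_self hq1 (k + B) hb)
  have hne := mul_ne_zero (qPoch_self_ne_zero hq1 (k + A)) (qPoch_self_ne_zero hq1 (k + B))
  have h := ((LJet.exp_mul (c * k)).mul (hd.inv hne)).mul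
    (LJet.const (w ^ k / qPoch q⁻¹ q⁻¹ (k + l)))
  convert h using 1
  · ext u
    simp only [Knot52.gterm, div_eq_mul_inv, mul_inv]
    ring
  · simp only [div_eq_mul_inv, mul_inv]
    ring
  · ring
  · ring

theorem JetSum_gterm {q w c a b : ℂ} (hq0 : q ≠ 0) (hq1 : ‖q‖ ≠ 1) (hw : w ≠ 0) (ha : a ≠ 0)
    (hb : b ≠ 0) (ha2 : ‖a‖ ≤ 2) (hb2 : ‖b‖ ≤ 2) (l A B : ℕ) :
    (∀ᶠ u in 𝓝[≠] 0, Summable fun k => gterm q w c a b l A B k u) ∧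
    JetSum (fun u => ∑' k, gterm q w c a b l A B k u)
      (fun k => w ^ k / (qPoch q⁻¹ q⁻¹ (k + l) * (qPoch q q (k + A) * qPoch q q (k + B))))
      (fun k => c * k + a * H (k + A) q + b * H (k + B) q)
      (fun k => (a ^ 2 * H2 (k + A) q + b ^ 2 * H2 (k + B) q) / 2) := by
  obtain ⟨ρ, hρ, hρ1, d, hd0, hd, ht⟩ := exists_factor_bound hq0 hq1
  set W : ℝ := ‖w‖ * Real.exp ‖c‖ with hW
  have hW0 : 0 < W := mul_pos (norm_pos_iff.2 hw) (Real.exp_pos _)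
  set D : ℕ → ℝ := fun k => ∏ i ∈ Finset.range k, d i with hD
  have hDpos : ∀ k, 0 < D k := fun k => Finset.prod_pos fun i _ => hd0 i
  set M : ℕ → ℝ := fun k => W ^ k / (‖qPoch q⁻¹ q⁻¹ (k + l)‖ * (D (k + A) * D (k + B))) with hM
  have hQ : ∀ k, 0 < ‖qPoch q⁻¹ q⁻¹ k‖ := fun k =>
    norm_pos_iff.2 (qPoch_self_ne_zero (norm_inv_ne_one hq1) k)
  have hMpos : ∀ k, 0 < M k := fun k =>
    div_pos (pow_pos hW0 k) (mul_pos (hQ _) (mul_pos (hDpos _) (hDpos _)))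
  have hMs : Summable M := by
    refine summable_of_ratio_test_tendsto_lt_one zero_lt_one
      (Eventually.of_forall fun k => (hMpos k).ne') ?_
    have : (fun k => ‖M (k + 1)‖ / ‖M k‖) =
        fun k => W / (‖1 - q⁻¹ ^ (k + l + 1)‖ * (d (k + A) * d (k + B))) := by
      ext k
      rw [Real.norm_of_nonneg (hMpos _).le, Real.norm_of_nonneg (hMpos _).le]
      simp only [hM, hD]
      rw [show k + 1 + l = k + l + 1 by ring, show k + 1 + A = k + A + 1 by ring,
        show k + 1 + B = k + B + 1 by ring, qPoch_succ, ← pow_succ', norm_mul,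
        Finset.prod_range_succ, Finset.prod_range_succ]
      have h1 := (hQ (k + l)).ne'
      have h2 := (hDpos (k + A)).ne'
      have h3 := (hDpos (k + B)).ne'
      have h4 := (hd0 (k + A)).ne'
      have h5 := (hd0 (k + B)).ne'
      have h6 : ‖1 - q⁻¹ ^ (k + l + 1)‖ ≠ 0 :=
        norm_ne_zero_iff.2 (one_sub_pow_ne_zero (norm_inv_ne_one hq1) (by simp))
      simp only [hD] at h2 h3
      generalize ‖qPoch q⁻¹ q⁻¹ (k + l)‖ = X at h1 ⊢
      generalize ‖1 - q⁻¹ ^ (k + l + 1)‖ = Y at h6 ⊢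
      field_simp
      ring
    rw [this]
    exact (ht l A B).const_div_atTop W
  have hlow : ∀ a : ℂ, ‖a‖ ≤ 2 → ∀ u ∈ Metric.ball (0 : ℂ) ρ, ∀ k,
      D k ≤ ‖qPoch (q * Complex.exp (a * u)) q k‖ := by
    intro a ha u hu k
    rw [qPoch, norm_prod]
    refine Finset.prod_le_prod (fun i _ => (hd0 i).le) fun i _ => ?_
    have hu' : ‖u‖ ≤ ρ := by simpa using (Metric.mem_ball.1 hu).le
    have := hd i (a * u) (by rw [norm_mul]; exact mul_le_mul ha hu' (norm_nonneg _) zero_le_two)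
    rwa [show q ^ (i + 1) * Complex.exp (a * u) = q * Complex.exp (a * u) * q ^ i by ring] at this
  have hbound : ∀ k, ∀ u ∈ Metric.ball (0 : ℂ) ρ, ‖gterm q w c a b l A B k u‖ ≤ M k := by
    intro k u hu
    have hu' : ‖u‖ ≤ 1 := by
      have : ‖u‖ ≤ ρ := by simpa using (Metric.mem_ball.1 hu).le
      exact this.trans hρ1
    rw [gterm, norm_div, norm_mul, norm_mul, norm_mul, norm_pow]
    have h1 : ‖Complex.exp (c * k * u)‖ ≤ Real.exp ‖c‖ ^ k := by
      rw [Complex.norm_exp, ← Real.exp_nat_mul, Real.exp_le_exp]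
      refine (Complex.re_le_norm _).trans ?_
      rw [norm_mul, norm_mul, Complex.norm_natCast]
      nlinarith [mul_nonneg (norm_nonneg c) (Nat.cast_nonneg (α := ℝ) k)]
    have h2 := hlow a ha2 u hu (k + A)
    have h3 := hlow b hb2 u hu (k + B)
    rw [hM]
    simp only [hW, mul_pow]
    have := hDpos (k + A)
    have := hDpos (k + B)
    have := hQ (k + l)
    gcongr
  have hdiff : ∀ k, DifferentiableOn ℂ (gterm q w c a b l A B k) (Metric.ball 0 ρ) := by
    intro k
    unfold gterm
    refine DifferentiableOn.div (by fun_prop) ?_ fun u hu => ?_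
    · unfold qPoch
      fun_prop
    · refine mul_ne_zero (norm_pos_iff.1 (hQ _)) (mul_ne_zero ?_ ?_)
      · exact norm_pos_iff.1 ((hDpos _).trans_le (hlow a ha2 u hu _))
      · exact norm_pos_iff.1 ((hDpos _).trans_le (hlow b hb2 u hu _))
  obtain ⟨s0, s1, s2, hJ⟩ := Jet.tsum hρ hdiff hbound hMs fun k => LJet.gterm hq1 ha hb l A B k
  exact ⟨(eventually_mem_ball hρ).mono fun u hu => .of_norm_bounded hMs fun k => hbound k u hu,
    s0, s1, s2, hJ⟩

theorem zpow_mul_inv_ne_one {q x : ℂ} (h : ∀ m : ℤ, q ^ m * x ≠ 1) (m : ℤ) : q ^ m * x⁻¹ ≠ 1 := by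
  intro h1
  apply h (-m)
  rw [zpow_neg, ← inv_inv x, ← mul_inv, h1, inv_one]

theorem zpow_mul_zpow_mul_ne_one {q x : ℂ} (hq0 : q ≠ 0) (h : ∀ m : ℤ, q ^ m * x ≠ 1) (n m : ℤ) :
    q ^ m * (q ^ n * x) ≠ 1 := by
  rw [← mul_assoc, ← zpow_add₀ hq0]
  exact h _

/-- The part of `B^{(2)}(q^n e^v; q)` that depends on `n` through a series. -/
def sig2 (q : ℂ) (n : ℤ) (v : ℂ) : ℂ :=
  ∑' k : ℕ, (q ^ n * Complex.exp v) ^ k / qPoch q⁻¹ q⁻¹ k *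
    (P (q ^ k * (q ^ n * Complex.exp v)) q / P (Complex.exp v) q *
      (P (q ^ k * (q ^ (2 * n) * Complex.exp (2 * v))) q / P (Complex.exp (2 * v)) q))

/-- The part of `B^{(1)}(q^n e^v; q)` that depends on `n` through a series. -/
def sig1 (q : ℂ) (n : ℤ) (v : ℂ) : ℂ :=
  ∑' k : ℕ, 1 / qPoch q⁻¹ q⁻¹ k *
    (P (q ^ k * (q ^ n * Complex.exp v)) q / P (Complex.exp v) q *
      (P (q ^ k * (q ^ (-n) * Complex.exp (-v))) q / P (Complex.exp (-v)) q))

/-- The block `B^{(2)}(q^n e^v; q)`, normalized at `v = 0`. -/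
def beta2 (s : ℂ) (n : ℤ) (v : ℂ) : ℂ :=
  B2 ((s ^ 2) ^ n * Complex.exp v) s *
    (v * kap (s ^ 2) (-v) / (theta 1 s * kap (s ^ 2) (2 * v)))

/-- The block `B^{(1)}(q^n e^v; q)`, normalized at `v = 0`. -/
def beta1 (s : ℂ) (n : ℤ) (v : ℂ) : ℂ :=
  B1 ((s ^ 2) ^ n * Complex.exp v) s / (theta 1 s * (kap (s ^ 2) v * kap (s ^ 2) (-v)))

/-- The function `P (e^v)`, normalized at `v = 0`. -/
def Ph (q v : ℂ) : ℂ := P (Complex.exp v) q / kap q v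

/-- The elementary factor of `beta2`. -/
def pref2 (s v : ℂ) : ℂ :=
  theta (Complex.exp v) s * (theta 1 s)⁻¹ * (Ph (s ^ 2) (2 * v) * (Ph (s ^ 2) (-1 * v))⁻¹) *
    ((Complex.exp (-1 * v) - 1) / (-1 * v))⁻¹

/-- The elementary factor of `beta1`. -/
def pref1 (s v : ℂ) : ℂ :=
  theta (Complex.exp v) s * (theta 1 s)⁻¹ * (Ph (s ^ 2) v * Ph (s ^ 2) (-1 * v))

theorem beta2_eq {s v : ℂ} (hs0 : s ≠ 0) (hs1 : ‖s‖ ≠ 1) (n : ℤ) (hv : v ≠ 0)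
    (h1 : ∀ m : ℤ, (s ^ 2) ^ m * Complex.exp v ≠ 1)
    (h2 : ∀ m : ℤ, (s ^ 2) ^ m * Complex.exp (2 * v) ≠ 1)
    (hP1 : P (Complex.exp v) (s ^ 2) ≠ 0) (hP2 : P (Complex.exp (2 * v)) (s ^ 2) ≠ 0)
    (hP3 : P (Complex.exp (-v)) (s ^ 2) ≠ 0) :
    beta2 s n v = (-s) ^ n * pref2 s v * sig2 (s ^ 2) n v := by
  have hq0 : s ^ 2 ≠ 0 := pow_ne_zero 2 hs0
  have hq1 := norm_sq_ne_one hs1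
  have hx0 := Complex.exp_ne_zero v
  have hx1 : Complex.exp v ≠ 1 := by simpa using h1 0
  have e2 : ((s ^ 2) ^ n * Complex.exp v) ^ 2 = (s ^ 2) ^ (2 * n) * Complex.exp (2 * v) := by
    rw [mul_pow, ← Complex.exp_nat_mul, mul_comm 2 n, zpow_mul]
    norm_cast
  have hB : B2 ((s ^ 2) ^ n * Complex.exp v) s = (-s) ^ n * (theta (Complex.exp v) s /
      ((1 - (Complex.exp v)⁻¹) * (P (Complex.exp v) (s ^ 2) * P (Complex.exp (-v)) (s ^ 2)))) *
      (P (Complex.exp v) (s ^ 2) * P (Complex.exp (2 * v)) (s ^ 2) * sig2 (s ^ 2) n v) := by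
    rw [B2, e2, G_eq_tsum hq0 hq1 (zpow_mul_zpow_mul_ne_one hq0 h1 n)
      (zpow_mul_zpow_mul_ne_one hq0 h2 (2 * n)), theta_zpow_mul hs0 hs1 hx0,
      show -s * ((s ^ 2) ^ n * Complex.exp v) = (s ^ 2) ^ n * (-s * Complex.exp v) by ring,
      theta_zpow_mul hs0 hs1 (mul_ne_zero (neg_ne_zero.2 hs0) hx0),
      theta_neg_mul hs0 hs1 hx0 hx1, Complex.exp_neg]
    congr 1
    · rw [mul_zpow]
      have a1 := zpow_ne_zero (-n ^ 2) hs0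
      have a2 := zpow_ne_zero (-n) hx0
      have a3 := zpow_ne_zero n (neg_ne_zero.2 hs0)
      rw [zpow_neg (-s)]
      generalize s ^ (-n ^ 2) = X at a1 ⊢
      generalize Complex.exp v ^ (-n) = Y at a2 ⊢
      generalize (-s) ^ n = Z at a3 ⊢
      field_simp
    · rw [sig2, ← tsum_mul_left]
      refine tsum_congr fun k => ?_
      field_simp
  have hk1 := kap_ne_zero hq1 (neg_ne_zero.2 hv)
  have hk2 := kap_ne_zero hq1 (mul_ne_zero two_ne_zero hv)
  have h3 : 1 - (Complex.exp v)⁻¹ ≠ 0 := by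
    rw [sub_ne_zero]; intro h; exact hx1 (inv_eq_one.1 h.symm)
  have h4 : ((Complex.exp v)⁻¹ - 1) ≠ 0 := by rw [← neg_sub]; exact neg_ne_zero.2 h3
  have h5 := (exists_LJet_theta_exp hs0 hs1).1
  rw [beta2, hB, pref2, Ph, Ph]
  simp only [neg_mul, one_mul, Complex.exp_neg] at hP3 ⊢
  rw [← neg_sub 1 (Complex.exp v)⁻¹]
  generalize Complex.exp (2 * v) = X2 at *
  generalize P (Complex.exp v)⁻¹ (s ^ 2) = X3 at *
  generalize 1 - (Complex.exp v)⁻¹ = X4 at *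
  field_simp

theorem beta1_eq {s v : ℂ} (hs0 : s ≠ 0) (hs1 : ‖s‖ ≠ 1) (n : ℤ)
    (h1 : ∀ m : ℤ, (s ^ 2) ^ m * Complex.exp v ≠ 1)
    (hP1 : P (Complex.exp v) (s ^ 2) ≠ 0) (hP3 : P (Complex.exp (-v)) (s ^ 2) ≠ 0) :
    beta1 s n v =
      s ^ (-n ^ 2) * Complex.exp (-n * v) * pref1 s v * sig1 (s ^ 2) n v := by
  have hq0 : s ^ 2 ≠ 0 := pow_ne_zero 2 hs0
  have hq1 := norm_sq_ne_one hs1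
  have hx0 := Complex.exp_ne_zero v
  have h3 : ∀ m : ℤ, (s ^ 2) ^ m * Complex.exp (-v) ≠ 1 := by
    rw [Complex.exp_neg]; exact zpow_mul_inv_ne_one h1
  have e1 : ((s ^ 2) ^ n * Complex.exp v)⁻¹ = (s ^ 2) ^ (-n) * Complex.exp (-v) := by
    rw [mul_inv, zpow_neg, Complex.exp_neg]
  have e2 : Complex.exp v ^ (-n) = Complex.exp (-n * v) := by
    rw [← Complex.exp_int_mul]; push_cast; rfl
  have hG : G ((s ^ 2) ^ n * Complex.exp v) ((s ^ 2) ^ n * Complex.exp v)⁻¹ 1 (s ^ 2) =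
      P (Complex.exp v) (s ^ 2) * P (Complex.exp (-v)) (s ^ 2) * sig1 (s ^ 2) n v := by
    rw [e1, G_eq_tsum hq0 hq1 (zpow_mul_zpow_mul_ne_one hq0 h1 n)
      (zpow_mul_zpow_mul_ne_one hq0 h3 (-n)), sig1, ← tsum_mul_left]
    refine tsum_congr fun k => ?_
    rw [one_pow]
    field_simp
  rw [beta1, B1, hG, theta_zpow_mul hs0 hs1 hx0, e2, pref1, Ph, Ph, neg_one_mul]
  simp only [div_eq_mul_inv, mul_inv]
  ring

theorem LJet_pref2 {s c : ℂ} (hs0 : s ≠ 0) (hs1 : ‖s‖ ≠ 1)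
    (hc : LJet (fun u => theta (Complex.exp u) s) (theta 1 s) 0 c) :
    LJet (pref2 s) 1 (-3 * (E 1 (s ^ 2) + 1 / 4) + 1 / 2)
      (c - 3 / 2 * (E 2 (s ^ 2) + 1 / 24) - 1 / 24) := by
  have hP := LJet_P (norm_sq_ne_one hs1)
  have h1 := hc.mul (LJet.const (theta 1 s)⁻¹)
  have h2 := (hP.scale two_ne_zero).mul ((hP.scale (l := -1) (by norm_num)).inv one_ne_zero)
  have h3 := (LJet.exp_sub_one_div.scale (l := -1) (by norm_num)).inv one_ne_zero
  have h4 := (h1.mul h2).mul h3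
  rw [mul_inv_cancel₀ (exists_LJet_theta_exp hs0 hs1).1] at h4
  convert h4 using 1
  · rfl
  · norm_num
  · ring
  · ring

theorem LJet_pref1 {s c : ℂ} (hs0 : s ≠ 0) (hs1 : ‖s‖ ≠ 1)
    (hc : LJet (fun u => theta (Complex.exp u) s) (theta 1 s) 0 c) :
    LJet (pref1 s) 1 0 (c - (E 2 (s ^ 2) + 1 / 24)) := by
  have hP := LJet_P (norm_sq_ne_one hs1)
  have h1 := hc.mul (LJet.const (theta 1 s)⁻¹)
  have h4 := h1.mul (hP.mul (hP.scale (l := -1) (by norm_num)))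
  rw [mul_inv_cancel₀ (exists_LJet_theta_exp hs0 hs1).1] at h4
  convert h4 using 1
  · rfl
  · norm_num
  · ring
  · ring

theorem eventually_P_ne_zero {q : ℂ} (hq1 : ‖q‖ ≠ 1) :
    ∀ᶠ u in 𝓝[≠] 0, P (Complex.exp u) q ≠ 0 := by
  filter_upwards [(LJet_P hq1).tendsto.eventually_ne one_ne_zero] with u h h0
  rw [h0, zero_div] at h
  exact h rfl

theorem qPoch_split {q x : ℂ} (r : ℕ) :
    qPoch x q⁻¹ (r + 1) = (1 - x) * qPoch (q⁻¹ * x) q⁻¹ r := by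
  rw [qPoch_succ', mul_comm x]

/-- `P (q^k q^{-m} x) / P (x)` for `k < m`. -/
theorem P_ratio_neg {q x : ℂ} (hq0 : q ≠ 0) (hq1 : ‖q‖ ≠ 1) (hx : ∀ m : ℤ, q ^ m * x ≠ 1)
    (hP : P x q ≠ 0) {m : ℤ} {k r : ℕ} (h : (k : ℤ) + m = -((r : ℤ) + 1)) :
    P (q ^ k * (q ^ m * x)) q / P x q = (1 - x) * qPoch (q⁻¹ * x) q⁻¹ r := by
  rw [← mul_assoc, ← zpow_natCast, ← zpow_add₀ hq0, h, zpow_neg, ← inv_zpow,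
    show (r : ℤ) + 1 = (r + 1 : ℕ) by push_cast; rfl, zpow_natCast, P_inv_pow_mul hq0 hq1 hx,
    mul_div_cancel_left₀ _ hP, qPoch_split]

theorem P_ratio_pos {q x : ℂ} (hq0 : q ≠ 0) (hq1 : ‖q‖ ≠ 1) (hx : ∀ m : ℤ, q ^ m * x ≠ 1)
    (hP : P x q ≠ 0) {m : ℤ} {k r : ℕ} (h : (k : ℤ) + m = r) :
    P (q ^ k * (q ^ m * x)) q / P x q = (qPoch (q * x) q r)⁻¹ := by
  rw [← mul_assoc, ← zpow_natCast, ← zpow_add₀ hq0, h, zpow_natCast, P_pow_mul hq0 hq1 hx,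
    div_div_cancel_left' hP]

theorem sig2_nonneg {q v : ℂ} (hq0 : q ≠ 0) (hq1 : ‖q‖ ≠ 1) (N : ℕ)
    (h1 : ∀ m : ℤ, q ^ m * Complex.exp v ≠ 1) (h2 : ∀ m : ℤ, q ^ m * Complex.exp (2 * v) ≠ 1)
    (hP1 : P (Complex.exp v) q ≠ 0) (hP2 : P (Complex.exp (2 * v)) q ≠ 0) :
    sig2 q N v = ∑' k, gterm q (q ^ N) 1 1 2 0 N (2 * N) k v := by
  refine tsum_congr fun k => ?_
  rw [P_ratio_pos hq0 hq1 h1 hP1 (r := k + N) (by push_cast; ring),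
    P_ratio_pos hq0 hq1 h2 hP2 (r := k + 2 * N) (by push_cast; ring), gterm, mul_pow,
    ← Complex.exp_nat_mul, zpow_natCast]
  simp only [div_eq_mul_inv, mul_inv, one_mul, add_zero]
  ring

theorem tsum_eq_sum_add {F f : ℕ → ℂ} (N : ℕ) (h : ∀ k, F (k + N) = f k) (hf : Summable f) :
    ∑' k, F k = ∑ k ∈ Finset.range N, F k + ∑' k, f k := by
  have hs : Summable F := (summable_nat_add_iff N).1 (by simpa only [h] using hf)
  rw [← hs.sum_add_tsum_nat_add N]
  simp only [h]

theorem sig1_eq {q v : ℂ} (hq0 : q ≠ 0) (hq1 : ‖q‖ ≠ 1) (N : ℕ)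
    (h1 : ∀ m : ℤ, q ^ m * Complex.exp v ≠ 1)
    (hP1 : P (Complex.exp v) q ≠ 0) (hP3 : P (Complex.exp (-v)) q ≠ 0)
    (hs : Summable fun k => gterm q 1 0 1 (-1) N (2 * N) 0 k v) :
    sig1 q N v = ∑ k ∈ Finset.range N, 1 / qPoch q⁻¹ q⁻¹ k *
        ((qPoch (q * Complex.exp v) q (k + N))⁻¹ *
          ((1 - Complex.exp (-v)) * qPoch (q⁻¹ * Complex.exp (-v)) q⁻¹ (N - k - 1)))
      + ∑' k, gterm q 1 0 1 (-1) N (2 * N) 0 k v := by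
  have h3 : ∀ m : ℤ, q ^ m * Complex.exp (-v) ≠ 1 := by
    rw [Complex.exp_neg]; exact zpow_mul_inv_ne_one h1
  rw [sig1, tsum_eq_sum_add N (fun k => ?_) hs]
  · congr 1
    refine Finset.sum_congr rfl fun k hk => ?_
    have hk' := Finset.mem_range.1 hk
    rw [P_ratio_pos hq0 hq1 h1 hP1 (r := k + N) (by push_cast; ring),
      P_ratio_neg hq0 hq1 h3 hP3 (r := N - k - 1) (by omega)]
  · rw [P_ratio_pos hq0 hq1 h1 hP1 (r := k + 2 * N) (by push_cast; ring),
      P_ratio_pos hq0 hq1 h3 hP3 (r := k + 0) (by push_cast; ring), gterm]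
    simp only [div_eq_mul_inv, mul_inv, one_mul, one_pow, zero_mul, Complex.exp_zero, neg_mul]

theorem sig2_neg {q v : ℂ} (hq0 : q ≠ 0) (hq1 : ‖q‖ ≠ 1) (N : ℕ)
    (h1 : ∀ m : ℤ, q ^ m * Complex.exp v ≠ 1) (h2 : ∀ m : ℤ, q ^ m * Complex.exp (2 * v) ≠ 1)
    (hP1 : P (Complex.exp v) q ≠ 0) (hP2 : P (Complex.exp (2 * v)) q ≠ 0)
    (hs : Summable fun k => gterm q (q ^ N)⁻¹ 1 1 2 (2 * N) N 0 k v) :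
    sig2 q (-N) v =
      ∑ k ∈ Finset.range N, ((q ^ N)⁻¹ * Complex.exp v) ^ k / qPoch q⁻¹ q⁻¹ k *
        (((1 - Complex.exp v) * qPoch (q⁻¹ * Complex.exp v) q⁻¹ (N - k - 1)) *
          ((1 - Complex.exp (2 * v)) * qPoch (q⁻¹ * Complex.exp (2 * v)) q⁻¹ (2 * N - k - 1)))
      + (∑ k ∈ Finset.range N, ((q ^ N)⁻¹ * Complex.exp v) ^ (k + N) / qPoch q⁻¹ q⁻¹ (k + N) *
        ((qPoch (q * Complex.exp v) q k)⁻¹ *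
          ((1 - Complex.exp (2 * v)) * qPoch (q⁻¹ * Complex.exp (2 * v)) q⁻¹ (N - k - 1)))
      + ((q ^ N)⁻¹ * Complex.exp v) ^ (2 * N) *
        ∑' k, gterm q (q ^ N)⁻¹ 1 1 2 (2 * N) N 0 k v) := by
  have hs' := hs.mul_left (((q ^ N)⁻¹ * Complex.exp v) ^ (2 * N))
  have hz : q ^ (-(N : ℤ)) = (q ^ N)⁻¹ := by rw [zpow_neg, zpow_natCast]
  rw [sig2, tsum_eq_sum_add (2 * N) (fun k => ?_) hs', tsum_mul_left, two_mul N,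
    Finset.sum_range_add, add_assoc, ← two_mul]
  · congr 1
    · refine Finset.sum_congr rfl fun k hk => ?_
      have hk' := Finset.mem_range.1 hk
      rw [P_ratio_neg hq0 hq1 h1 hP1 (r := N - k - 1) (by omega),
        P_ratio_neg hq0 hq1 h2 hP2 (r := 2 * N - k - 1) (by omega), hz]
    · congr 1
      refine Finset.sum_congr rfl fun k hk => ?_
      have hk' := Finset.mem_range.1 hk
      rw [P_ratio_pos hq0 hq1 h1 hP1 (r := k) (by push_cast; ring),
        P_ratio_neg hq0 hq1 h2 hP2 (r := N - k - 1) (by omega), hz, add_comm N k]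
  · rw [P_ratio_pos hq0 hq1 h1 hP1 (r := k + N) (by push_cast; ring),
      P_ratio_pos hq0 hq1 h2 hP2 (r := k + 0) (by push_cast; ring), hz, pow_add, gterm,
      mul_pow _ _ k, ← Complex.exp_nat_mul v k]
    simp only [div_eq_mul_inv, mul_inv, one_mul]
    ring

theorem qPoch_inv {s : ℂ} (hs0 : s ≠ 0) (m : ℕ) :
    qPoch (s ^ 2)⁻¹ (s ^ 2)⁻¹ m * s ^ (m * (m + 1)) = (-1) ^ m * qPoch (s ^ 2) (s ^ 2) m := by
  induction m with
  | zero => simp [qPoch_zero]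
  | succ m ih =>
    have h : (1 - (s ^ 2)⁻¹ * (s ^ 2)⁻¹ ^ m) * s ^ (2 * m + 2) = -(1 - s ^ 2 * (s ^ 2) ^ m) := by
      rw [← pow_succ', ← pow_succ', inv_pow, ← pow_mul, sub_mul, show 2 * (m + 1) = 2 * m + 2 by ring,
        inv_mul_cancel₀ (pow_ne_zero _ hs0)]
      ring
    rw [qPoch_succ, qPoch_succ, show (m + 1) * (m + 1 + 1) = m * (m + 1) + (2 * m + 2) by ring, pow_add,
      mul_mul_mul_comm, ih, h]
    ring

theorem qPoch_ratio {s : ℂ} (hs0 : s ≠ 0) (hs1 : ‖s‖ ≠ 1) (k m : ℕ) :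
    (qPoch (s ^ 2)⁻¹ (s ^ 2)⁻¹ (k + m))⁻¹ * (qPoch (s ^ 2) (s ^ 2) k)⁻¹ =
      (-1) ^ m * s ^ (m * (m + 1) + 2 * k * m) *
        ((qPoch (s ^ 2)⁻¹ (s ^ 2)⁻¹ k)⁻¹ * (qPoch (s ^ 2) (s ^ 2) (k + m))⁻¹) := by
  have h1 := qPoch_inv hs0 k
  have h2 := qPoch_inv hs0 (k + m)
  have hne := qPoch_self_ne_zero (norm_sq_ne_one hs1)
  have hne' := qPoch_self_ne_zero (norm_inv_ne_one (norm_sq_ne_one hs1))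
  have n1 := hne k
  have n2 := hne (k + m)
  have n3 := hne' k
  have n4 := hne' (k + m)
  rw [← mul_inv, ← mul_inv, inv_eq_iff_eq_inv, mul_inv, inv_inv]
  rw [eq_inv_mul_iff_mul_eq₀ (mul_ne_zero (pow_ne_zero _ (by norm_num)) (pow_ne_zero _ hs0))]
  apply mul_right_cancel₀ (pow_ne_zero (k * (k + 1)) hs0)
  have hk : ((-1 : ℂ) ^ k) * (-1) ^ k = 1 := by rw [← mul_pow]; simp
  have hm : ((-1 : ℂ) ^ m) * (-1) ^ m = 1 := by rw [← mul_pow]; simp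
  calc _ = (-1) ^ m * (qPoch (s ^ 2)⁻¹ (s ^ 2)⁻¹ (k + m) * s ^ ((k + m) * (k + m + 1))) *
        qPoch (s ^ 2) (s ^ 2) k := by
        rw [show (k + m) * (k + m + 1) = m * (m + 1) + 2 * k * m + k * (k + 1) by ring, pow_add _ _ (k * (k + 1))]
        ring
    _ = ((-1) ^ m * (-1) ^ m) * (qPoch (s ^ 2) (s ^ 2) (k + m)) * ((-1) ^ k * qPoch (s ^ 2) (s ^ 2) k) := by
        rw [h2, pow_add]; ring
    _ = _ := by rw [hm, ← h1]; ring

theorem zpow_neg_natCast_sq (s : ℂ) (N : ℕ) : s ^ (-(N : ℤ) ^ 2) = (s ^ N ^ 2)⁻¹ := by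
  rw [zpow_neg, ← zpow_natCast]; push_cast; rfl

theorem coeff_beta2 (s : ℂ) (N k : ℕ) :
    (-s) ^ N * (((s ^ 2) ^ N) ^ k / (qPoch (s ^ 2)⁻¹ (s ^ 2)⁻¹ (k + 0) *
      (qPoch (s ^ 2) (s ^ 2) (k + N) * qPoch (s ^ 2) (s ^ 2) (k + 2 * N)))) =
    (-1) ^ N * s ^ N * term0 N (s ^ 2) k := by
  rw [term0, add_zero, neg_pow, pow_mul]
  ring

theorem coeff_beta1 {s : ℂ} (hs0 : s ≠ 0) (hs1 : ‖s‖ ≠ 1) (N k : ℕ) :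
    (s ^ N ^ 2)⁻¹ * (1 ^ k / (qPoch (s ^ 2)⁻¹ (s ^ 2)⁻¹ (k + N) *
      (qPoch (s ^ 2) (s ^ 2) (k + 2 * N) * qPoch (s ^ 2) (s ^ 2) (k + 0)))) =
    (-1) ^ N * s ^ N * term0 N (s ^ 2) k := by
  have h := qPoch_ratio hs0 hs1 k N
  simp only [term0, div_eq_mul_inv, mul_inv, add_zero, one_pow] at h ⊢
  calc _ = (s ^ N ^ 2)⁻¹ * (qPoch (s ^ 2) (s ^ 2) (k + 2 * N))⁻¹ *
        ((qPoch (s ^ 2)⁻¹ (s ^ 2)⁻¹ (k + N))⁻¹ * (qPoch (s ^ 2) (s ^ 2) k)⁻¹) := by ring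
    _ = _ := by
      rw [h, show N * (N + 1) + 2 * k * N = N ^ 2 + (N + 2 * (N * k)) by ring, pow_add, pow_add,
        ← pow_mul]
      field_simp

theorem coeff_beta2_neg {s : ℂ} (hs0 : s ≠ 0) (hs1 : ‖s‖ ≠ 1) (N k : ℕ) :
    ((-s) ^ N)⁻¹ * (((s ^ 2) ^ N)⁻¹ ^ (2 * N) * (((s ^ 2) ^ N)⁻¹ ^ k /
      (qPoch (s ^ 2)⁻¹ (s ^ 2)⁻¹ (k + 2 * N) *
        (qPoch (s ^ 2) (s ^ 2) (k + N) * qPoch (s ^ 2) (s ^ 2) (k + 0))))) =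
    (-1) ^ N * s ^ N * term0 N (s ^ 2) k := by
  have h := qPoch_ratio hs0 hs1 k (2 * N)
  have h2 : (-1 : ℂ) ^ (2 * N) = 1 := by simp [pow_mul]
  have hm : ((-1 : ℂ) ^ N)⁻¹ = (-1) ^ N := by rw [← inv_pow]; norm_num
  simp only [term0, div_eq_mul_inv, mul_inv, add_zero] at h ⊢
  calc _ = ((-s) ^ N)⁻¹ * ((s ^ 2) ^ N)⁻¹ ^ (2 * N) * ((s ^ 2) ^ N)⁻¹ ^ k *
        (qPoch (s ^ 2) (s ^ 2) (k + N))⁻¹ *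
        ((qPoch (s ^ 2)⁻¹ (s ^ 2)⁻¹ (k + 2 * N))⁻¹ * (qPoch (s ^ 2) (s ^ 2) k)⁻¹) := by ring
    _ = _ := by
      rw [h, show 2 * N * (2 * N + 1) + 2 * k * (2 * N) =
        N + N + 2 * N * (2 * N) + 2 * N * k + 2 * (N * k) by ring, neg_pow s, mul_inv, hm, h2]
      simp only [pow_add, inv_pow, ← pow_mul]
      field_simp

/-- The summand of the finite sum in the formula for `h^{(1)}`. -/
def finTerm (s : ℂ) (N k : ℕ) : ℂ :=
  qPoch (s ^ 2)⁻¹ (s ^ 2)⁻¹ (N - 1 - k) /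
    (qPoch (s ^ 2)⁻¹ (s ^ 2)⁻¹ k * qPoch (s ^ 2) (s ^ 2) (k + N))

theorem coeff_fin {s : ℂ} (hs0 : s ≠ 0) (hs1 : ‖s‖ ≠ 1) (N k : ℕ) :
    ((-s) ^ N)⁻¹ * (((s ^ 2) ^ N)⁻¹ ^ (k + N) / qPoch (s ^ 2)⁻¹ (s ^ 2)⁻¹ (k + N) *
      ((qPoch (s ^ 2) (s ^ 2) k)⁻¹ * qPoch (s ^ 2)⁻¹ (s ^ 2)⁻¹ (N - 1 - k))) =
    (s ^ N ^ 2)⁻¹ * finTerm s N k := by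
  have h := qPoch_ratio hs0 hs1 k N
  have hm : ((-1 : ℂ) ^ N)⁻¹ = (-1) ^ N := by rw [← inv_pow]; norm_num
  have hN : ((-1 : ℂ) ^ N) * (-1) ^ N = 1 := by rw [← mul_pow]; simp
  simp only [finTerm, div_eq_mul_inv, mul_inv] at h ⊢
  calc _ = ((-s) ^ N)⁻¹ * ((s ^ 2) ^ N)⁻¹ ^ (k + N) * qPoch (s ^ 2)⁻¹ (s ^ 2)⁻¹ (N - 1 - k) *
        ((qPoch (s ^ 2)⁻¹ (s ^ 2)⁻¹ (k + N))⁻¹ * (qPoch (s ^ 2) (s ^ 2) k)⁻¹) := by ring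
    _ = ((-1 : ℂ) ^ N) * (-1) ^ N * ((s ^ N)⁻¹ * ((s ^ 2) ^ N)⁻¹ ^ (k + N) *
        s ^ (N * (N + 1) + 2 * k * N)) * (qPoch (s ^ 2)⁻¹ (s ^ 2)⁻¹ (N - 1 - k) *
        ((qPoch (s ^ 2)⁻¹ (s ^ 2)⁻¹ k)⁻¹ * (qPoch (s ^ 2) (s ^ 2) (k + N))⁻¹)) := by
      rw [h, neg_pow s, mul_inv, hm]; ring
    _ = _ := by
      rw [hN, one_mul]
      congr 1
      rw [show N * (N + 1) + 2 * k * N = N * N + N + 2 * N * k by ring]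
      simp only [pow_add, inv_pow, ← pow_mul]
      rw [show 2 * N * N = N ^ 2 + N * N by ring, pow_add]
      field_simp

theorem H_inv {q : ℂ} (hq0 : q ≠ 0) (hq1 : ‖q‖ ≠ 1) (r : ℕ) : H r q⁻¹ = -(r + H r q) := by
  have h : ∀ j ∈ Finset.Icc 1 r, q⁻¹ ^ j / (1 - q⁻¹ ^ j) = -(1 + q ^ j / (1 - q ^ j)) := by
    intro j hj
    have hj' := (Finset.mem_Icc.1 hj).1
    have h1 := one_sub_pow_ne_zero hq1 (m := j) (by omega)
    have h2 : q ^ j - 1 ≠ 0 := by rw [← neg_sub]; exact neg_ne_zero.2 h1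
    have h3 := pow_ne_zero j hq0
    rw [inv_pow]
    generalize q ^ j = y at *
    rw [show y⁻¹ / (1 - y⁻¹) = 1 / (y - 1) by
      rw [show (1 : ℂ) - y⁻¹ = (y - 1) / y by field_simp]; field_simp, ← neg_sub 1 y]
    field_simp
    ring
  rw [H, H, Finset.sum_congr rfl h, Finset.sum_neg_distrib, Finset.sum_add_distrib]
  simp

/-- Half the difference of the linear coefficients of the two blocks `beta2`. -/
def diffFactor (N : ℕ) (q : ℂ) (k : ℕ) : ℂ := H (k + 2 * N) q - H k q - N

theorem jet_beta2_pos {s c : ℂ} (hs0 : s ≠ 0) (hs1 : ‖s‖ ≠ 1)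
    (hc : LJet (fun u => theta (Complex.exp u) s) (theta 1 s) 0 c) (N : ℕ) :
    JetSum (beta2 s N) (fun k => (-1) ^ N * s ^ N * term0 N (s ^ 2) k)
      (fun k => linFactor N (s ^ 2) k + diffFactor N (s ^ 2) k)
      (fun k => c - 3 / 2 * (E 2 (s ^ 2) + 1 / 24) - 1 / 24 +
        (H2 (k + N) (s ^ 2) + 4 * H2 (k + 2 * N) (s ^ 2)) / 2) := by
  have hq0 : s ^ 2 ≠ 0 := pow_ne_zero 2 hs0
  have hq1 := norm_sq_ne_one hs1
  have h := ((JetSum_gterm (q := s ^ 2) (w := (s ^ 2) ^ N) (c := 1) (a := 1) (b := 2) hq0 hq1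
    (pow_ne_zero N hq0) one_ne_zero two_ne_zero (by norm_num) (by norm_num) 0 N (2 * N)).2.mul
    (LJet_pref2 hs0 hs1 hc)).mul (LJet.const ((-s) ^ N))
  refine h.congr ?_ (fun k => ?_) (fun k => ?_) (fun k => ?_)
  · have hg := eventually_generic hq0 hq1
    have hP := eventually_P_ne_zero hq1
    filter_upwards [self_mem_nhdsWithin, hg, hP,
      (tendsto_const_mul_punctured two_ne_zero).eventually hg,
      (tendsto_const_mul_punctured two_ne_zero).eventually hP,
      (tendsto_const_mul_punctured (neg_ne_zero.2 one_ne_zero)).eventually hP] with v hv g1 p1 g2 p2 p3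
    rw [neg_one_mul] at p3
    rw [beta2_eq hs0 hs1 N hv g1 g2 p1 p2 p3, sig2_nonneg hq0 hq1 N g1 g2 p1 p2, zpow_natCast,
      mul_assoc]
  · rw [one_mul, coeff_beta2]
  · rw [linFactor, diffFactor]; ring
  · ring

theorem jet_beta1 {s c : ℂ} (hs0 : s ≠ 0) (hs1 : ‖s‖ ≠ 1)
    (hc : LJet (fun u => theta (Complex.exp u) s) (theta 1 s) 0 c) (N : ℕ) :
    ∃ f g, (∀ᶠ u in 𝓝[≠] 0, beta1 s N u = f u + g u) ∧
      JetSum f (fun k => (-1) ^ N * s ^ N * term0 N (s ^ 2) k) (diffFactor N (s ^ 2))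
        (fun k => c - (E 2 (s ^ 2) + 1 / 24) + (H2 (k + 2 * N) (s ^ 2) + H2 k (s ^ 2)) / 2) ∧
      Jet g 0 (∑ k ∈ Finset.range N, (s ^ N ^ 2)⁻¹ * finTerm s N k)
        (∑ k ∈ Finset.range N, (s ^ N ^ 2)⁻¹ * finTerm s N k *
          (-N + H (k + N) (s ^ 2) - ((N - 1 - k : ℕ) + H (N - 1 - k) (s ^ 2)) - 1 / 2)) := by
  have hq0 : s ^ 2 ≠ 0 := pow_ne_zero 2 hs0
  have hq1 := norm_sq_ne_one hs1
  have hpre := ((LJet.const (s ^ N ^ 2)⁻¹).mul (LJet.exp_mul (-N))).mul (LJet_pref1 hs0 hs1 hc)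
  have hS := JetSum_gterm (q := s ^ 2) (w := 1) (c := 0) (a := 1) (b := -1) hq0 hq1
    one_ne_zero one_ne_zero (by norm_num) (by norm_num) (by norm_num) N (2 * N) 0
  have hF : ∀ k ∈ Finset.range N, LJet _ _ _ _ := fun k _ =>
    (hpre.mul (LJet.exp_sub_one_div.scale (l := -1) (by norm_num))).mul
      ((LJet.const (1 / qPoch (s ^ 2)⁻¹ (s ^ 2)⁻¹ k)).mul
        (((LJet.qPoch_self hq1 (k + N) one_ne_zero).inv (qPoch_self_ne_zero hq1 _)).mul
        (LJet.qPoch_self (norm_inv_ne_one hq1) (N - 1 - k) (a := -1) (by norm_num))))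
  refine ⟨_, _, ?_, (hS.2.mul hpre).congr (Eventually.of_forall fun u => rfl) (fun k => ?_)
    (fun k => ?_) (fun k => ?_), (Jet.sum (Finset.range N) hF).id_mul.of_eq rfl ?_ ?_⟩
  rotate_left
  · rw [mul_one, mul_one, coeff_beta1 hs0 hs1]
  · simp only [diffFactor, add_zero]; ring
  · simp only [add_zero]; ring
  · refine Finset.sum_congr rfl fun k _ => ?_
    rw [finTerm]; ring
  · refine Finset.sum_congr rfl fun k _ => ?_
    rw [finTerm, H_inv hq0 hq1]; ring
  · have hg := eventually_generic hq0 hq1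
    have hP := eventually_P_ne_zero hq1
    filter_upwards [self_mem_nhdsWithin, hg, hP,
      (tendsto_const_mul_punctured (neg_ne_zero.2 one_ne_zero)).eventually hP, hS.1]
      with v hv g1 p1 p3 hs
    have hv' : v ≠ 0 := hv
    rw [neg_one_mul] at p3
    rw [beta1_eq hs0 hs1 N g1 p1 p3, sig1_eq hq0 hq1 N g1 p1 p3 hs, zpow_neg_natCast_sq, mul_add,
      add_comm]
    congr 1
    rw [Finset.mul_sum, Finset.mul_sum]
    refine Finset.sum_congr rfl fun k _ => ?_
    rw [Int.cast_natCast, neg_one_mul, one_mul, show N - k - 1 = N - 1 - k by omega]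
    field_simp
    ring_nf

theorem jet_beta2_neg {s c : ℂ} (hs0 : s ≠ 0) (hs1 : ‖s‖ ≠ 1)
    (hc : LJet (fun u => theta (Complex.exp u) s) (theta 1 s) 0 c) (N : ℕ) :
    ∃ f g, (∀ᶠ u in 𝓝[≠] 0, beta2 s (-N) u = f u + g u) ∧
      JetSum f (fun k => (-1) ^ N * s ^ N * term0 N (s ^ 2) k)
        (fun k => linFactor N (s ^ 2) k - diffFactor N (s ^ 2) k)
        (fun k => c - 3 / 2 * (E 2 (s ^ 2) + 1 / 24) - 1 / 24 +
          (H2 (k + N) (s ^ 2) + 4 * H2 k (s ^ 2)) / 2) ∧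
      Jet g 0 (∑ k ∈ Finset.range N, -2 * ((s ^ N ^ 2)⁻¹ * finTerm s N k))
        (∑ k ∈ Finset.range N, -2 * ((s ^ N ^ 2)⁻¹ * finTerm s N k) *
          (-3 * (E 1 (s ^ 2) + 1 / 4) + 1 / 2 + (k + N) + H k (s ^ 2)
            + 2 * ((N - 1 - k : ℕ) + H (N - 1 - k) (s ^ 2)) + 1) +
        ∑ k ∈ Finset.range N, 2 * ((-s) ^ N)⁻¹ * (((s ^ 2) ^ N)⁻¹ ^ k *
          (qPoch (s ^ 2)⁻¹ (s ^ 2)⁻¹ (2 * N - k - 1) * qPoch (s ^ 2)⁻¹ (s ^ 2)⁻¹ (N - k - 1) /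
            qPoch (s ^ 2)⁻¹ (s ^ 2)⁻¹ k))) := by
  have hq0 : s ^ 2 ≠ 0 := pow_ne_zero 2 hs0
  have hq1 := norm_sq_ne_one hs1
  have hpre := (LJet.const ((-s) ^ N)⁻¹).mul (LJet_pref2 hs0 hs1 hc)
  have hpow : ∀ k : ℕ, LJet (fun u => ((s ^ 2) ^ N)⁻¹ ^ k * Complex.exp (k * u))
      (((s ^ 2) ^ N)⁻¹ ^ k) k 0 := fun k => by
    simpa using (LJet.const (((s ^ 2) ^ N)⁻¹ ^ k)).mul (LJet.exp_mul k)
  have hS := JetSum_gterm (q := s ^ 2) (w := ((s ^ 2) ^ N)⁻¹) (c := 1) (a := 1) (b := 2) hq0 hq1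
    (inv_ne_zero (pow_ne_zero N hq0)) one_ne_zero two_ne_zero (by norm_num) (by norm_num) (2 * N) N 0
  have hpre' := hpre.mul (hpow (2 * N))
  have hE2 := LJet.exp_sub_one_div.scale (l := 2) two_ne_zero
  have hF : ∀ k ∈ Finset.range N, LJet _ _ _ _ := fun k _ =>
    ((LJet.const (-2)).mul (hpre.mul hE2)).mul
      ((hpow (k + N)).mul ((LJet.const (1 / qPoch (s ^ 2)⁻¹ (s ^ 2)⁻¹ (k + N))).mul
        (((LJet.qPoch_self hq1 k one_ne_zero).inv (qPoch_self_ne_zero hq1 _)).mul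
        (LJet.qPoch_self (norm_inv_ne_one hq1) (N - 1 - k) (a := 2) two_ne_zero))))
  have hF' : ∀ k ∈ Finset.range N, LJet _ _ _ _ := fun k _ =>
    ((LJet.const 2).mul (hpre.mul (hE2.mul LJet.exp_sub_one_div))).mul
      ((hpow k).mul ((LJet.const (1 / qPoch (s ^ 2)⁻¹ (s ^ 2)⁻¹ k)).mul
        ((LJet.qPoch_self (norm_inv_ne_one hq1) (N - k - 1) (a := 1) one_ne_zero).mul
        (LJet.qPoch_self (norm_inv_ne_one hq1) (2 * N - k - 1) (a := 2) two_ne_zero))))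
  refine ⟨_, _, ?_, (hS.2.mul hpre').congr (Eventually.of_forall fun u => rfl) (fun k => ?_)
    (fun k => ?_) (fun k => ?_), ((Jet.sum (Finset.range N) hF).id_mul.add
      (Jet.sum (Finset.range N) hF').id_mul.id_mul).of_eq ?_ ?_ ?_⟩
  rotate_left
  · rw [mul_one, mul_assoc ((-s) ^ N)⁻¹, coeff_beta2_neg hs0 hs1]
  · rw [diffFactor, linFactor, add_zero]; push_cast; ring
  · simp only [add_zero]; ring
  · rw [add_zero]
  · rw [add_zero]
    refine Finset.sum_congr rfl fun k _ => ?_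
    rw [← coeff_fin hs0 hs1]; ring
  · congr 1
    · refine Finset.sum_congr rfl fun k _ => ?_
      rw [← coeff_fin hs0 hs1, H_inv hq0 hq1]; push_cast; ring
    · refine Finset.sum_congr rfl fun k _ => ?_
      ring
  · have hg := eventually_generic hq0 hq1
    have hP := eventually_P_ne_zero hq1
    filter_upwards [self_mem_nhdsWithin, hg, hP,
      (tendsto_const_mul_punctured two_ne_zero).eventually hg,
      (tendsto_const_mul_punctured two_ne_zero).eventually hP,
      (tendsto_const_mul_punctured (neg_ne_zero.2 one_ne_zero)).eventually hP, hS.1]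
      with v hv g1 p1 g2 p2 p3 hs
    have hv' : v ≠ 0 := hv
    rw [neg_one_mul] at p3
    have key : ∀ {c S₁ S₂ X T a b : ℂ}, c * S₁ = b → c * S₂ = a →
        c * (S₁ + (S₂ + X * T)) = c * X * T + (a + b) := by
      rintro c S₁ S₂ X T a b rfl rfl; ring
    rw [beta2_eq hs0 hs1 (-N) hv g1 g2 p1 p2 p3, sig2_neg hq0 hq1 N g1 g2 p1 p2 hs, zpow_neg,
      zpow_natCast]
    simp only [mul_pow _ (Complex.exp v), ← Complex.exp_nat_mul v]
    refine key ?_ ?_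
    · rw [Finset.mul_sum, Finset.mul_sum, Finset.mul_sum]
      refine Finset.sum_congr rfl fun k _ => ?_
      rw [one_mul]
      field_simp
      ring_nf
    · rw [Finset.mul_sum, Finset.mul_sum]
      refine Finset.sum_congr rfl fun k _ => ?_
      rw [one_mul, show N - k - 1 = N - 1 - k by omega]
      field_simp
      ring_nf

/-- The closed formulas for the colored holomorphic blocks, as functions of `N = |n|`. -/
def blockValue (α : Fin 3) (N : ℕ) (s : ℂ) : ℂ :=
  match α with
  | 0 => (-1) ^ N * s ^ N * ∑' k : ℕ, term0 N (s ^ 2) k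
  | 1 => -(-1) ^ N * s ^ N * ∑' k : ℕ, term1 N (s ^ 2) k
      + (s ^ N ^ 2)⁻¹ * ∑ k ∈ Finset.range N, finTerm s N k
  | 2 => (-1) ^ N * s ^ N * ∑' k : ℕ, term2 N (s ^ 2) k
      + 2 * (s ^ N ^ 2)⁻¹ * ∑ k ∈ Finset.range N, finTerm s N k *
          ((N : ℂ) - 3 / 4 - 3 * E 1 (s ^ 2) + H k (s ^ 2) + H (k + N) (s ^ 2)
            + H (N - k - 1) (s ^ 2))
      - 2 * (-1) ^ N * (s ^ N)⁻¹ * ∑ k ∈ Finset.range N,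
          ((s ^ 2) ^ (N * k))⁻¹ *
          (qPoch (s ^ 2)⁻¹ (s ^ 2)⁻¹ (2 * N - k - 1) *
            qPoch (s ^ 2)⁻¹ (s ^ 2)⁻¹ (N - k - 1) / qPoch (s ^ 2)⁻¹ (s ^ 2)⁻¹ k)

theorem summable_of_mul_left {K : ℂ} (hK : K ≠ 0) {f : ℕ → ℂ} (h : Summable fun k => K * f k) :
    Summable f := (summable_mul_left_iff hK).1 h

theorem jets {s : ℂ} (hs0 : s ≠ 0) (hs1 : ‖s‖ ≠ 1) (N : ℕ) :
    (Summable (term0 N (s ^ 2)) ∧ Summable (term1 N (s ^ 2)) ∧ Summable (term2 N (s ^ 2))) ∧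
    (∃ b c, Jet (beta1 s N) (blockValue 0 N s) b c) ∧
    (∃ c, Jet (fun u => beta2 s N u - beta2 s (-N) (-u)) 0 (-2 * blockValue 1 N s) c) ∧
    Jet (fun u => 2 * beta1 s N u - beta2 s N u - beta2 s (-N) (-u)) 0 0 (blockValue 2 N s) := by
  obtain ⟨-, c, hc⟩ := exists_LJet_theta_exp hs0 hs1
  have hX := jet_beta2_pos hs0 hs1 hc N
  obtain ⟨fZ, gZ, eZ, hZ, hZ'⟩ := jet_beta1 hs0 hs1 hc N
  obtain ⟨fY, gY, eY, hY, hY'⟩ := jet_beta2_neg hs0 hs1 hc N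
  set K : ℂ := (-1) ^ N * s ^ N with hK
  have hK0 : K ≠ 0 := mul_ne_zero (pow_ne_zero _ (by norm_num)) (pow_ne_zero _ hs0)
  have jZ := (hZ.jet.add hZ').congr eZ
  have jY := ((hY.jet.add hY').congr eY).scale (l := -1) (by norm_num)
  simp only [neg_one_mul] at jY
  have jX := hX.jet
  have s0 : Summable (term0 N (s ^ 2)) := summable_of_mul_left hK0 hX.summable₀
  have e1 : (fun k => K * (2 * term1 N (s ^ 2) k)) = fun k =>
      K * term0 N (s ^ 2) k * (linFactor N (s ^ 2) k + diffFactor N (s ^ 2) k) +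
      K * term0 N (s ^ 2) k * (linFactor N (s ^ 2) k - diffFactor N (s ^ 2) k) := by
    ext k; rw [term1]; ring
  have s1' : Summable fun k => 2 * term1 N (s ^ 2) k := by
    refine summable_of_mul_left hK0 ?_
    rw [e1]
    exact hX.summable₁.add hY.summable₁
  have s1 : Summable (term1 N (s ^ 2)) := summable_of_mul_left two_ne_zero s1'
  have e0 : ∀ k, K * term0 N (s ^ 2) k * diffFactor N (s ^ 2) k * 2 =
      K * term0 N (s ^ 2) k * (linFactor N (s ^ 2) k + diffFactor N (s ^ 2) k) -
      K * term0 N (s ^ 2) k * (linFactor N (s ^ 2) k - diffFactor N (s ^ 2) k) := fun k => by ring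
  have t1 := congrArg tsum e1
  rw [tsum_mul_left, tsum_mul_left, hX.summable₁.tsum_add hY.summable₁] at t1
  have t0 := congrArg tsum (funext e0)
  rw [tsum_mul_right, hX.summable₁.tsum_sub hY.summable₁] at t0
  have e2 : ∀ k, K * term2 N (s ^ 2) k = 2 * (K * term0 N (s ^ 2) k * (diffFactor N (s ^ 2) k ^ 2 / 2 +
        (c - (E 2 (s ^ 2) + 1 / 24) + (H2 (k + 2 * N) (s ^ 2) + H2 k (s ^ 2)) / 2))) -
      K * term0 N (s ^ 2) k * ((linFactor N (s ^ 2) k + diffFactor N (s ^ 2) k) ^ 2 / 2 +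
        (c - 3 / 2 * (E 2 (s ^ 2) + 1 / 24) - 1 / 24 +
          (H2 (k + N) (s ^ 2) + 4 * H2 (k + 2 * N) (s ^ 2)) / 2)) -
      K * term0 N (s ^ 2) k * ((linFactor N (s ^ 2) k - diffFactor N (s ^ 2) k) ^ 2 / 2 +
        (c - 3 / 2 * (E 2 (s ^ 2) + 1 / 24) - 1 / 24 +
          (H2 (k + N) (s ^ 2) + 4 * H2 k (s ^ 2)) / 2)) := fun k => by
    rw [term2]; ring
  have s2 : Summable (term2 N (s ^ 2)) := by
    refine summable_of_mul_left hK0 ?_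
    rw [funext e2]
    exact ((hZ.summable₂.mul_left 2).sub hX.summable₂).sub hY.summable₂
  have t2 := congrArg tsum (funext e2)
  rw [tsum_mul_left, ((hZ.summable₂.mul_left 2).sub hX.summable₂).tsum_sub hY.summable₂,
    (hZ.summable₂.mul_left 2).tsum_sub hX.summable₂, tsum_mul_left] at t2
  have f1 : ∑ k ∈ Finset.range N, -2 * ((s ^ N ^ 2)⁻¹ * finTerm s N k) =
      -2 * ∑ k ∈ Finset.range N, (s ^ N ^ 2)⁻¹ * finTerm s N k := by rw [Finset.mul_sum]
  refine ⟨⟨s0, s1, s2⟩, ⟨_, _, jZ.of_eq ?_ rfl rfl⟩, ⟨_, (jX.sub jY).of_eq ?_ ?_ rfl⟩,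
    (((jZ.const_mul 2).sub jX).sub jY).of_eq ?_ ?_ ?_⟩
  · rw [blockValue, tsum_mul_left, add_zero]
  · ring
  · rw [f1, ← Finset.mul_sum, blockValue, show -(-1) ^ N * s ^ N = -K by rw [hK]; ring]
    linear_combination t1
  · ring
  · rw [f1]
    linear_combination -t0
  · have f2 : ∑ k ∈ Finset.range N, finTerm s N k *
          ((N : ℂ) - 3 / 4 - 3 * E 1 (s ^ 2) + H k (s ^ 2) + H (k + N) (s ^ 2)
            + H (N - k - 1) (s ^ 2)) * (2 * (s ^ N ^ 2)⁻¹) =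
        2 * ∑ k ∈ Finset.range N, (s ^ N ^ 2)⁻¹ * finTerm s N k *
          (-N + H (k + N) (s ^ 2) - ((N - 1 - k : ℕ) + H (N - 1 - k) (s ^ 2)) - 1 / 2) -
        ∑ k ∈ Finset.range N, -2 * ((s ^ N ^ 2)⁻¹ * finTerm s N k) *
          (-3 * (E 1 (s ^ 2) + 1 / 4) + 1 / 2 + (k + N) + H k (s ^ 2)
            + 2 * ((N - 1 - k : ℕ) + H (N - 1 - k) (s ^ 2)) + 1) := by
      rw [Finset.mul_sum, ← Finset.sum_sub_distrib]
      refine Finset.sum_congr rfl fun k hk => ?_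
      have hk' := Finset.mem_range.1 hk
      have hcast : ((N - 1 - k : ℕ) : ℂ) = N - 1 - k := by
        rw [Nat.cast_sub (by omega), Nat.cast_sub (by omega), Nat.cast_one]
      rw [show N - k - 1 = N - 1 - k by omega, hcast]
      ring
    have hm : ((-1 : ℂ) ^ N)⁻¹ = (-1) ^ N := by rw [← inv_pow]; norm_num
    have f3 : (∑ k ∈ Finset.range N, 2 * ((-s) ^ N)⁻¹ * (((s ^ 2) ^ N)⁻¹ ^ k *
          (qPoch (s ^ 2)⁻¹ (s ^ 2)⁻¹ (2 * N - k - 1) * qPoch (s ^ 2)⁻¹ (s ^ 2)⁻¹ (N - k - 1) /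
            qPoch (s ^ 2)⁻¹ (s ^ 2)⁻¹ k))) =
        2 * (-1) ^ N * (s ^ N)⁻¹ * ∑ k ∈ Finset.range N, ((s ^ 2) ^ (N * k))⁻¹ *
          (qPoch (s ^ 2)⁻¹ (s ^ 2)⁻¹ (2 * N - k - 1) *
            qPoch (s ^ 2)⁻¹ (s ^ 2)⁻¹ (N - k - 1) / qPoch (s ^ 2)⁻¹ (s ^ 2)⁻¹ k) := by
      rw [Finset.mul_sum]
      refine Finset.sum_congr rfl fun k _ => ?_
      rw [neg_pow s, mul_inv, hm, inv_pow, ← pow_mul]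
      ring
    rw [← Finset.sum_mul] at f2
    rw [f3, blockValue, ← hK]
    linear_combination t2 + f2

/-- Near `0` the logarithmic derivative of `℘` is `-2 / u`, up to an error of relative order
`u ^ 3`. -/
theorem jet_wpLogDeriv {s : ℂ} (hs0 : s ≠ 0) (hs1 : ‖s‖ ≠ 1) :
    Jet (fun u => -(u / 2) * wpLogDeriv s hs0 hs1 u) 1 0 0 := by
  set Λ := periods s hs0 hs1
  have hP := Λ.analyticAt_weierstrassPExcept 0
  have hP' := Λ.analyticAt_derivWeierstrassPExcept 0
  have b' : Bdd (Λ.derivWeierstrassPExcept 0) :=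
    Bdd.of_tendsto (hP'.continuousAt.tendsto.mono_left nhdsWithin_le_nhds)
  have b : Bdd (dslope (Λ.weierstrassPExcept 0) 0) :=
    Bdd.of_tendsto ((continuousAt_dslope_same.2 hP.differentiableAt).tendsto.mono_left
      nhdsWithin_le_nhds)
  have j1 : Jet (fun u => u ^ 2 * Λ.weierstrassP u) 1 0 0 := by
    refine ⟨_, b, ?_⟩
    filter_upwards [self_mem_nhdsWithin] with u hu
    have hu' : u ≠ 0 := hu
    have h := Λ.weierstrassPExcept_def 0 u
    have h2 := eq_add_mul_dslope (Λ.weierstrassPExcept 0) u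
    simp only [Submodule.coe_zero, Λ.weierstrassPExcept_zero, sub_zero] at h h2
    rw [h] at h2
    have h3 : Λ.weierstrassP u = u * dslope (Λ.weierstrassPExcept 0) 0 u + 1 / u ^ 2 := by
      rw [zero_add] at h2
      linear_combination h2
    rw [h3]
    field_simp
    ring
  have j2 : Jet (fun u => u ^ 3 * Λ.derivWeierstrassP u) (-2) 0 0 := by
    refine ⟨_, b', ?_⟩
    filter_upwards [self_mem_nhdsWithin] with u hu
    have hu' : u ≠ 0 := hu
    have h := Λ.derivWeierstrassPExcept_def 0 u
    simp only [Submodule.coe_zero, sub_zero] at h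
    rw [h]
    field_simp
    ring
  refine (((j2.mul (j1.inv one_ne_zero)).const_mul (-1 / 2)).of_eq (by norm_num) (by norm_num)
    (by norm_num)).congr ?_
  filter_upwards [self_mem_nhdsWithin] with u hu
  have hu' : u ≠ 0 := hu
  change -(u / 2) * (Λ.derivWeierstrassP u / Λ.weierstrassP u) = _
  field_simp

theorem isBigO_neg {f : ℂ → ℂ} {m : ℤ}
    (h : f =O[𝓝[≠] 0] fun u : ℂ => u ^ m) : (fun u => f (-u)) =O[𝓝[≠] 0] fun u : ℂ => u ^ m := by
  have h1 := h.comp_tendsto (tendsto_const_mul_punctured (neg_ne_zero.2 one_ne_zero))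
  simp only [Function.comp_def, neg_one_mul] at h1
  refine h1.trans (IsBigO.of_bound 1 (Eventually.of_forall fun u => ?_))
  simp [norm_zpow]

/-- Multiplication by a constant multiple of `u ^ m` shifts the order. -/
theorem isBigO_mul_zpow {f g : ℂ → ℂ} {m n l : ℤ} (k : ℂ) (h : f =O[𝓝[≠] 0] fun u : ℂ => u ^ m)
    (hl : m + n = l) (hg : ∀ᶠ u in 𝓝[≠] 0, g u = k * u ^ n * f u) :
    g =O[𝓝[≠] 0] fun u : ℂ => u ^ l := by
  have h1 : (fun u : ℂ => k * u ^ n) =O[𝓝[≠] 0] fun u : ℂ => u ^ n :=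
    (isBigO_refl _ _).const_mul_left k
  refine (h1.mul h).congr' (hg.mono fun u hu => hu.symm) ?_
  filter_upwards [self_mem_nhdsWithin] with u hu
  rw [← zpow_add₀ hu, add_comm n, hl]

theorem B3_eq (x s : ℂ) : B3 x s = B2 x⁻¹ s := rfl

theorem G_swap (x y z q : ℂ) : G x y z q = G y x z q := by
  unfold G
  split_ifs
  · rw [mul_comm (qPochInf (q * x) q)]
    simp only [mul_right_comm _ (qPoch (q * x) q _)]
  · rw [mul_comm (qPochInf x q⁻¹)]
    simp only [mul_right_comm _ (qPoch (q * x) q _)]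

theorem B1_inv (x s : ℂ) : B1 x⁻¹ s = B1 x s := by
  rw [B1, B1, theta_inv_left, inv_inv, G_swap]

theorem wpLogDeriv_neg (s : ℂ) (hs0 : s ≠ 0) (hs1 : ‖s‖ ≠ 1) (u : ℂ) :
    wpLogDeriv s hs0 hs1 (-u) = -wpLogDeriv s hs0 hs1 u := by
  rw [wpLogDeriv, wpLogDeriv, PeriodPair.derivWeierstrassP_neg, PeriodPair.weierstrassP_neg, neg_div]

theorem isBlockInside_zero_iff {n : ℤ} {s : ℂ} {hs0 : s ≠ 0} {hs1 : ‖s‖ ≠ 1} {h : ℂ} :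
    IsBlockInside 0 n s hs0 hs1 h ↔
      (fun u => B1 ((s ^ 2) ^ n * Complex.exp u) s -
        qPochInf (-s) (s ^ 2) ^ 2 * qPochInf (s ^ 2) (s ^ 2) ^ 2 * h)
      =O[𝓝[≠] 0] fun u : ℂ => u ^ (1 : ℤ) := by
  simp only [zpow_one]; rfl

theorem isBlockInside_one_iff {n : ℤ} {s : ℂ} {hs0 : s ≠ 0} {hs1 : ‖s‖ ≠ 1} {h : ℂ} :
    IsBlockInside 1 n s hs0 hs1 h ↔
      (fun u => B2 ((s ^ 2) ^ n * Complex.exp u) s + B3 ((s ^ 2) ^ n * Complex.exp u) s -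
        (-2 * qPochInf (-s) (s ^ 2) ^ 2 * h))
      =O[𝓝[≠] 0] fun u : ℂ => u ^ (1 : ℤ) := by
  simp only [zpow_one]; rfl

theorem isBlockOutside_zero_iff {n : ℤ} {s : ℂ} {hs0 : s ≠ 0} {hs1 : ‖s‖ ≠ 1} {h : ℂ} :
    IsBlockOutside 0 n s hs0 hs1 h ↔
      (fun u => -B1 ((s ^ 2) ^ (-n) * Complex.exp (-u)) s⁻¹ -
        1 / (qPochInf (-s) (s ^ 2) ^ 2 * qPochInf (s ^ 2) (s ^ 2) ^ 2) * h * (u ^ 2)⁻¹)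
      =O[𝓝[≠] 0] fun u : ℂ => u ^ (-1 : ℤ) := by
  simp only [zpow_neg_one]; rfl

theorem isBlockOutside_one_iff {n : ℤ} {s : ℂ} {hs0 : s ≠ 0} {hs1 : ‖s‖ ≠ 1} {h : ℂ} :
    IsBlockOutside 1 n s hs0 hs1 h ↔
      (fun u => B2 ((s ^ 2) ^ (-n) * Complex.exp (-u)) s⁻¹ +
        B3 ((s ^ 2) ^ (-n) * Complex.exp (-u)) s⁻¹ - 1 / qPochInf (-s) (s ^ 2) ^ 2 * h)
      =O[𝓝[≠] 0] fun u : ℂ => u ^ (1 : ℤ) := by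
  simp only [zpow_one]; rfl

theorem IsBlockInside.neg {α : Fin 3} {n : ℤ} {s : ℂ} {hs0 : s ≠ 0} {hs1 : ‖s‖ ≠ 1} {h : ℂ}
    (H : IsBlockInside α n s hs0 hs1 h) : IsBlockInside α (-n) s hs0 hs1 h := by
  have hx : ∀ u : ℂ, (s ^ 2) ^ (-n) * Complex.exp u = ((s ^ 2) ^ n * Complex.exp (-u))⁻¹ := by
    intro u; rw [mul_inv, zpow_neg, Complex.exp_neg, inv_inv]
  match α with
  | 0 =>
    refine isBlockInside_zero_iff.2 ((isBigO_neg (isBlockInside_zero_iff.1 H)).congr_left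
      fun u => ?_)
    rw [hx, B1_inv]
  | 1 =>
    refine isBlockInside_one_iff.2 ((isBigO_neg (isBlockInside_one_iff.1 H)).congr_left
      fun u => ?_)
    simp only [hx, B3_eq, inv_inv]
    ring
  | 2 =>
    have h1 := (isBigO_neg (m := 2) H).neg_left
    refine h1.congr_left fun u => ?_
    simp only [hx, B1_inv, B3_eq, inv_inv, wpLogDeriv_neg]
    ring

theorem IsBlockOutside.neg {α : Fin 3} {n : ℤ} {s : ℂ} {hs0 : s ≠ 0} {hs1 : ‖s‖ ≠ 1} {h : ℂ}
    (H : IsBlockOutside α n s hs0 hs1 h) : IsBlockOutside α (-n) s hs0 hs1 h := by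
  have hx : ∀ u : ℂ, (s ^ 2) ^ (- -n) * Complex.exp (-u) =
      ((s ^ 2) ^ (-n) * Complex.exp (- -u))⁻¹ := by
    intro u; rw [mul_inv, zpow_neg, Complex.exp_neg (-u), inv_inv]
  match α with
  | 0 =>
    refine isBlockOutside_zero_iff.2 ((isBigO_neg (isBlockOutside_zero_iff.1 H)).congr_left
      fun u => ?_)
    rw [hx, B1_inv, neg_neg, neg_sq]
  | 1 =>
    refine isBlockOutside_one_iff.2 ((isBigO_neg (isBlockOutside_one_iff.1 H)).congr_left
      fun u => ?_)
    simp only [hx, B3_eq, inv_inv]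
    ring
  | 2 =>
    have h1 := (isBigO_neg (m := 2) H).neg_left
    refine h1.congr_left fun u => ?_
    simp only [hx, B1_inv, B3_eq, inv_inv, wpLogDeriv_neg, div_neg]
    ring

theorem B1_eq_beta1 {s u : ℂ} (hs0 : s ≠ 0) (hs1 : ‖s‖ ≠ 1) (hu : u ≠ 0) (n : ℤ) :
    B1 ((s ^ 2) ^ n * Complex.exp u) s =
      beta1 s n u * (theta 1 s * (kap (s ^ 2) u * kap (s ^ 2) (-u))) := by
  have h := norm_sq_ne_one hs1
  rw [beta1, div_mul_cancel₀]
  exact mul_ne_zero (exists_LJet_theta_exp hs0 hs1).1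
    (mul_ne_zero (kap_ne_zero h hu) (kap_ne_zero h (neg_ne_zero.2 hu)))

theorem B2_eq_beta2 {s u : ℂ} (hs0 : s ≠ 0) (hs1 : ‖s‖ ≠ 1) (hu : u ≠ 0) (n : ℤ) :
    B2 ((s ^ 2) ^ n * Complex.exp u) s =
      beta2 s n u * (theta 1 s * kap (s ^ 2) (2 * u) / (u * kap (s ^ 2) (-u))) := by
  have h := norm_sq_ne_one hs1
  have h1 := (exists_LJet_theta_exp hs0 hs1).1
  have h2 := kap_ne_zero h (mul_ne_zero two_ne_zero hu)
  have h3 := kap_ne_zero h (neg_ne_zero.2 hu)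
  rw [beta2]
  generalize kap (s ^ 2) (2 * u) = K at h2 ⊢
  generalize kap (s ^ 2) (-u) = K' at h3 ⊢
  field_simp

theorem B3_eq_beta2 {s u : ℂ} (hs0 : s ≠ 0) (hs1 : ‖s‖ ≠ 1) (hu : u ≠ 0) (n : ℤ) :
    B3 ((s ^ 2) ^ n * Complex.exp u) s =
      beta2 s (-n) (-u) * (theta 1 s * kap (s ^ 2) (2 * -u) / (-u * kap (s ^ 2) u)) := by
  have := B2_eq_beta2 hs0 hs1 (neg_ne_zero.2 hu) (-n)
  rw [neg_neg] at this
  rw [B3_eq, ← this, mul_inv, zpow_neg, Complex.exp_neg]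

theorem isBlockInside_blockValue {s : ℂ} (hs0 : s ≠ 0) (hs1 : ‖s‖ ≠ 1) (h : ‖s‖ < 1) (α : Fin 3)
    (N : ℕ) : IsBlockInside α N s hs0 hs1 (blockValue α N s) := by
  have hq := norm_sq_lt_one.2 h
  have hκ := qPochInf_self_ne_zero hq
  have hk : ∀ v, kap (s ^ 2) v = qPochInf (s ^ 2) (s ^ 2) := fun v => by rw [kap, if_pos hq]
  obtain ⟨-, ⟨b, c, j0⟩, ⟨d, j1⟩, j2⟩ := jets hs0 hs1 N
  have e1 : ∀ u : ℂ, u ≠ 0 → B1 ((s ^ 2) ^ (N : ℤ) * Complex.exp u) s =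
      beta1 s N u * (qPochInf (-s) (s ^ 2) ^ 2 * qPochInf (s ^ 2) (s ^ 2) ^ 2) := fun u hu => by
    rw [B1_eq_beta1 hs0 hs1 hu, theta_one_of_norm_lt_one h, hk, hk]
    ring
  have e2 : ∀ u : ℂ, u ≠ 0 → B2 ((s ^ 2) ^ (N : ℤ) * Complex.exp u) s =
      beta2 s N u * qPochInf (-s) (s ^ 2) ^ 2 / u := fun u hu => by
    rw [B2_eq_beta2 hs0 hs1 hu, theta_one_of_norm_lt_one h, hk, hk]
    field_simp
  have e3 : ∀ u : ℂ, u ≠ 0 → B3 ((s ^ 2) ^ (N : ℤ) * Complex.exp u) s =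
      -(beta2 s (-N) (-u) * qPochInf (-s) (s ^ 2) ^ 2 / u) := fun u hu => by
    rw [B3_eq_beta2 hs0 hs1 hu, theta_one_of_norm_lt_one h, hk, hk]
    field_simp
  match α with
  | 0 =>
    have := isBigO_mul_zpow (m := 1) (n := 0) (l := 1)
      (g := fun u => B1 ((s ^ 2) ^ (N : ℤ) * Complex.exp u) s -
        qPochInf (-s) (s ^ 2) ^ 2 * qPochInf (s ^ 2) (s ^ 2) ^ 2 * blockValue 0 N s)
      (qPochInf (-s) (s ^ 2) ^ 2 * qPochInf (s ^ 2) (s ^ 2) ^ 2)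
      (by simpa only [zpow_one] using j0.isBigO₁) rfl ?_
    · exact isBlockInside_zero_iff.2 this
    · filter_upwards [self_mem_nhdsWithin] with u hu
      rw [e1 u hu, zpow_zero]; ring
  | 1 =>
    have := isBigO_mul_zpow (m := 2) (n := -1) (l := 1)
      (g := fun u => B2 ((s ^ 2) ^ (N : ℤ) * Complex.exp u) s +
        B3 ((s ^ 2) ^ (N : ℤ) * Complex.exp u) s -
        (-2 * qPochInf (-s) (s ^ 2) ^ 2 * blockValue 1 N s))
      (qPochInf (-s) (s ^ 2) ^ 2) j1.isBigO₂ rfl ?_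
    · exact isBlockInside_one_iff.2 this
    · filter_upwards [self_mem_nhdsWithin] with u hu
      have hu' : u ≠ 0 := hu
      rw [e2 u hu, e3 u hu, zpow_neg_one]
      field_simp
      ring
  | 2 =>
    have jW := jet_wpLogDeriv hs0 hs1
    have j3 := ((((j0.const_mul 2).mul jW).sub (j0.const_mul 2)).add j2).isBigO₃
    refine isBigO_mul_zpow (m := 3) (n := -1) (l := 2) (qPochInf (-s) (s ^ 2) ^ 2) j3 rfl ?_
    filter_upwards [self_mem_nhdsWithin] with u hu
    have hu' : u ≠ 0 := hu
    simp only [e1 u hu, e2 u hu, e3 u hu, zpow_neg_one]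
    field_simp
    ring

theorem isBlockOutside_blockValue {s : ℂ} (hs0 : s ≠ 0) (hs1 : ‖s‖ ≠ 1) (hs0' : s⁻¹ ≠ 0)
    (hs1' : ‖s⁻¹‖ ≠ 1) (h : 1 < ‖s‖) (α : Fin 3) (N : ℕ) :
    IsBlockOutside α N s⁻¹ hs0' hs1' (blockValue α N s) := by
  have h' : ‖s⁻¹‖ < 1 := by rw [norm_inv]; exact inv_lt_one_of_one_lt₀ h
  have hq' : ¬‖s ^ 2‖ < 1 := mt norm_sq_lt_one.1 (not_lt.2 h.le)
  have hp : ‖s⁻¹ ^ 2‖ < 1 := norm_sq_lt_one.2 h'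
  have hκ := qPochInf_self_ne_zero hp
  have hθ : theta 1 s = (qPochInf (-s⁻¹) (s⁻¹ ^ 2) ^ 2)⁻¹ := by
    rw [← theta_one_of_norm_lt_one h', theta_inv_right hs0 hs1, inv_inv]
  have hθ0 : qPochInf (-s⁻¹) (s⁻¹ ^ 2) ≠ 0 :=
    qPochInf_ne_zero hp (one_sub_neg_mul_pow_ne_zero h')
  have hk : ∀ v, kap (s ^ 2) v = -(qPochInf (s⁻¹ ^ 2) (s⁻¹ ^ 2) * v)⁻¹ := fun v => by
    rw [kap, if_neg hq', inv_pow]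
  have hx : (s⁻¹ ^ 2) ^ (-(N : ℤ)) = (s ^ 2) ^ (N : ℤ) := by
    rw [inv_pow, inv_zpow, zpow_neg, inv_inv]
  obtain ⟨-, ⟨b, c, j0⟩, ⟨d, j1⟩, j2⟩ := jets hs0 hs1 N
  have neg1 : (-1 : ℂ) ≠ 0 := by norm_num
  have i0 := j0.scale neg1
  have i1 := j1.scale neg1
  have i2 := j2.scale neg1
  simp only [neg_one_mul, neg_neg] at i0 i1 i2
  have e1 : ∀ u : ℂ, u ≠ 0 → B1 ((s ^ 2) ^ (N : ℤ) * Complex.exp (-u)) s =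
      -(beta1 s N (-u) / (qPochInf (-s⁻¹) (s⁻¹ ^ 2) ^ 2 * qPochInf (s⁻¹ ^ 2) (s⁻¹ ^ 2) ^ 2 * u ^ 2)) :=
    fun u hu => by
    rw [B1_eq_beta1 hs0 hs1 (neg_ne_zero.2 hu), hθ, hk, hk, neg_neg]
    clear hθ hk
    generalize qPochInf (s⁻¹ ^ 2) (s⁻¹ ^ 2) = κ at hκ ⊢
    generalize qPochInf (-s⁻¹) (s⁻¹ ^ 2) = t at hθ0 ⊢
    field_simp
  have e2 : ∀ u : ℂ, u ≠ 0 → B2 ((s ^ 2) ^ (N : ℤ) * Complex.exp (-u)) s =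
      beta2 s N (-u) / (2 * qPochInf (-s⁻¹) (s⁻¹ ^ 2) ^ 2 * u) := fun u hu => by
    rw [B2_eq_beta2 hs0 hs1 (neg_ne_zero.2 hu), hθ, hk, hk, neg_neg]
    clear hθ hk
    generalize qPochInf (s⁻¹ ^ 2) (s⁻¹ ^ 2) = κ at hκ ⊢
    generalize qPochInf (-s⁻¹) (s⁻¹ ^ 2) = t at hθ0 ⊢
    field_simp
  have e3 : ∀ u : ℂ, u ≠ 0 → B3 ((s ^ 2) ^ (N : ℤ) * Complex.exp (-u)) s =
      -(beta2 s (-N) u / (2 * qPochInf (-s⁻¹) (s⁻¹ ^ 2) ^ 2 * u)) := fun u hu => by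
    rw [B3_eq_beta2 hs0 hs1 (neg_ne_zero.2 hu), hθ, hk, hk, neg_neg]
    clear hθ hk
    generalize qPochInf (s⁻¹ ^ 2) (s⁻¹ ^ 2) = κ at hκ ⊢
    generalize qPochInf (-s⁻¹) (s⁻¹ ^ 2) = t at hθ0 ⊢
    field_simp
  match α with
  | 0 =>
    have := isBigO_mul_zpow (m := 1) (n := -2) (l := -1)
      (g := fun u => -B1 ((s⁻¹ ^ 2) ^ (-(N : ℤ)) * Complex.exp (-u)) s⁻¹⁻¹ -
        1 / (qPochInf (-s⁻¹) (s⁻¹ ^ 2) ^ 2 * qPochInf (s⁻¹ ^ 2) (s⁻¹ ^ 2) ^ 2) *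
          blockValue 0 N s * (u ^ 2)⁻¹)
      (1 / (qPochInf (-s⁻¹) (s⁻¹ ^ 2) ^ 2 * qPochInf (s⁻¹ ^ 2) (s⁻¹ ^ 2) ^ 2))
      (by simpa only [zpow_one] using i0.isBigO₁) rfl ?_
    · exact isBlockOutside_zero_iff.2 this
    · filter_upwards [self_mem_nhdsWithin] with u hu
      have hu' : u ≠ 0 := hu
      rw [hx, inv_inv, e1 u hu, show u ^ (-2 : ℤ) = (u ^ 2)⁻¹ from zpow_neg u 2]
      field_simp
  | 1 =>
    have := isBigO_mul_zpow (m := 2) (n := -1) (l := 1)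
      (g := fun u => B2 ((s⁻¹ ^ 2) ^ (-(N : ℤ)) * Complex.exp (-u)) s⁻¹⁻¹ +
        B3 ((s⁻¹ ^ 2) ^ (-(N : ℤ)) * Complex.exp (-u)) s⁻¹⁻¹ -
        1 / qPochInf (-s⁻¹) (s⁻¹ ^ 2) ^ 2 * blockValue 1 N s)
      (1 / (2 * qPochInf (-s⁻¹) (s⁻¹ ^ 2) ^ 2)) i1.isBigO₂ rfl ?_
    · exact isBlockOutside_one_iff.2 this
    · filter_upwards [self_mem_nhdsWithin] with u hu
      have hu' : u ≠ 0 := hu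
      rw [hx, inv_inv, e2 u hu, e3 u hu, zpow_neg_one]
      field_simp
      ring
  | 2 =>
    have jW := (jet_wpLogDeriv hs0' hs1').inv one_ne_zero
    have j3 := ((((i0.const_mul 2).mul jW).sub (i0.const_mul 2)).add i2).isBigO₃
    refine isBigO_mul_zpow (m := 3) (n := -1) (l := 2)
      (1 / qPochInf (-s⁻¹) (s⁻¹ ^ 2) ^ 2) j3 rfl ?_
    filter_upwards [self_mem_nhdsWithin] with u hu
    have hu' : u ≠ 0 := hu
    simp only [hx, inv_inv, e1 u hu, e2 u hu, e3 u hu, zpow_neg_one, mul_inv]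
    generalize (wpLogDeriv s⁻¹ hs0' hs1' u) = w
    simp only [div_eq_mul_inv, mul_inv]
    generalize w⁻¹ = w
    clear hθ hk e1 e2 e3
    generalize qPochInf (s⁻¹ ^ 2) (s⁻¹ ^ 2) = κ at hκ ⊢
    generalize qPochInf (-s⁻¹) (s⁻¹ ^ 2) = t at hθ0 ⊢
    field_simp
    ring

theorem isColoredBlock_blockValue (α : Fin 3) (n : ℤ) {s : ℂ} (hs0 : s ≠ 0) (hs1 : ‖s‖ ≠ 1) :
    IsColoredBlock α n s hs0 hs1 (blockValue α n.natAbs s) := by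
  rcases Int.natAbs_eq n with hn | hn
  · rw [hn, Int.natAbs_natCast]
    exact ⟨fun h => isBlockInside_blockValue hs0 hs1 h α _,
      fun h => isBlockOutside_blockValue hs0 hs1 _ _ h α _⟩
  · rw [hn, Int.natAbs_neg, Int.natAbs_natCast]
    exact ⟨fun h => (isBlockInside_blockValue hs0 hs1 h α _).neg,
      fun h => (isBlockOutside_blockValue hs0 hs1 _ _ h α _).neg⟩

/-- A multiple of `u ^ m` that is `O(u ^ (m + 1))` vanishes. -/
theorem eq_of_isBigO {f : ℂ → ℂ} {k a b : ℂ} {m l : ℤ} (hk : k ≠ 0) (hl : m + 1 = l)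
    (ha : (fun u => f u - k * a * u ^ m) =O[𝓝[≠] 0] fun u : ℂ => u ^ l)
    (hb : (fun u => f u - k * b * u ^ m) =O[𝓝[≠] 0] fun u : ℂ => u ^ l) : a = b := by
  have h := isBigO_mul_zpow (n := -m) (l := 1) (g := fun _ => b - a) k⁻¹ (ha.sub hb)
    (by omega) (by
      filter_upwards [self_mem_nhdsWithin] with u hu
      have hu' : u ^ m ≠ 0 := zpow_ne_zero m hu
      rw [zpow_neg]
      field_simp
      ring)
  have h0 : Tendsto (fun _ : ℂ => b - a) (𝓝[≠] (0 : ℂ)) (𝓝 0) := by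
    refine h.trans_tendsto ?_
    simp only [zpow_one]
    exact tendsto_id.mono_left nhdsWithin_le_nhds
  exact (sub_eq_zero.1 (tendsto_nhds_unique tendsto_const_nhds h0)).symm

theorem IsBlockInside.unique {α : Fin 3} {n : ℤ} {s : ℂ} {hs0 : s ≠ 0} {hs1 : ‖s‖ ≠ 1} {a b : ℂ}
    (h : ‖s‖ < 1) (ha : IsBlockInside α n s hs0 hs1 a) (hb : IsBlockInside α n s hs0 hs1 b) :
    a = b := by
  have hq := norm_sq_lt_one.2 h
  have hκ := pow_ne_zero 2 (qPochInf_self_ne_zero hq)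
  have hθ := pow_ne_zero 2 (qPochInf_ne_zero hq (one_sub_neg_mul_pow_ne_zero h))
  match α with
  | 0 =>
    refine eq_of_isBigO (f := fun u => B1 ((s ^ 2) ^ n * Complex.exp u) s) (m := 0) (l := 1)
      (mul_ne_zero hθ hκ) rfl ?_ ?_
    · simpa only [zpow_zero, mul_one] using isBlockInside_zero_iff.1 ha
    · simpa only [zpow_zero, mul_one] using isBlockInside_zero_iff.1 hb
  | 1 =>
    refine eq_of_isBigO (f := fun u => B2 ((s ^ 2) ^ n * Complex.exp u) s +
      B3 ((s ^ 2) ^ n * Complex.exp u) s) (m := 0) (l := 1) (mul_ne_zero (by norm_num : (-2 : ℂ) ≠ 0) hθ) rfl ?_ ?_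
    · simpa only [zpow_zero, mul_one] using isBlockInside_one_iff.1 ha
    · simpa only [zpow_zero, mul_one] using isBlockInside_one_iff.1 hb
  | 2 =>
    refine eq_of_isBigO (f := fun u => -B1 ((s ^ 2) ^ n * Complex.exp u) s *
      (wpLogDeriv s hs0 hs1 u / qPochInf (s ^ 2) (s ^ 2) ^ 2) -
      B2 ((s ^ 2) ^ n * Complex.exp u) s + B3 ((s ^ 2) ^ n * Complex.exp u) s)
      (m := 1) (l := 2) hθ rfl ?_ ?_
    · simp only [zpow_one]; exact ha
    · simp only [zpow_one]; exact hb

theorem IsBlockOutside.unique {α : Fin 3} {n : ℤ} {s : ℂ} {hs0 : s ≠ 0} {hs1 : ‖s‖ ≠ 1} {a b : ℂ}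
    (h : ‖s‖ < 1) (ha : IsBlockOutside α n s hs0 hs1 a) (hb : IsBlockOutside α n s hs0 hs1 b) :
    a = b := by
  have hq := norm_sq_lt_one.2 h
  have hκ := pow_ne_zero 2 (qPochInf_self_ne_zero hq)
  have hθ := pow_ne_zero 2 (qPochInf_ne_zero hq (one_sub_neg_mul_pow_ne_zero h))
  match α with
  | 0 =>
    refine eq_of_isBigO (f := fun u => -B1 ((s ^ 2) ^ (-n) * Complex.exp (-u)) s⁻¹)
      (m := -2) (l := -1) (one_div_ne_zero (mul_ne_zero hθ hκ)) rfl ?_ ?_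
    · exact isBlockOutside_zero_iff.1 ha
    · exact isBlockOutside_zero_iff.1 hb
  | 1 =>
    refine eq_of_isBigO (f := fun u => B2 ((s ^ 2) ^ (-n) * Complex.exp (-u)) s⁻¹ +
      B3 ((s ^ 2) ^ (-n) * Complex.exp (-u)) s⁻¹) (m := 0) (l := 1) (one_div_ne_zero hθ) rfl ?_ ?_
    · simpa only [zpow_zero, mul_one] using isBlockOutside_one_iff.1 ha
    · simpa only [zpow_zero, mul_one] using isBlockOutside_one_iff.1 hb
  | 2 =>
    refine eq_of_isBigO (f := fun u => 2 * (2 * B1 ((s ^ 2) ^ (-n) * Complex.exp (-u)) s⁻¹ *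
      (qPochInf (s ^ 2) (s ^ 2) ^ 2 / wpLogDeriv s hs0 hs1 u) -
      B2 ((s ^ 2) ^ (-n) * Complex.exp (-u)) s⁻¹ + B3 ((s ^ 2) ^ (-n) * Complex.exp (-u)) s⁻¹))
      (m := 1) (l := 2) (one_div_ne_zero hθ) rfl ?_ ?_
    · simp only [zpow_one, one_div_mul_eq_div]; exact ha
    · simp only [zpow_one, one_div_mul_eq_div]; exact hb

theorem IsColoredBlock.unique {α : Fin 3} {n : ℤ} {s : ℂ} {hs0 : s ≠ 0} {hs1 : ‖s‖ ≠ 1} {a b : ℂ}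
    (ha : IsColoredBlock α n s hs0 hs1 a) (hb : IsColoredBlock α n s hs0 hs1 b) : a = b := by
  rcases lt_or_gt_of_ne hs1 with h | h
  · exact (ha.1 h).unique h (hb.1 h)
  · exact (ha.2 h).unique (by rw [norm_inv]; exact inv_lt_one_of_one_lt₀ h) (hb.2 h)

theorem coloredBlock_eq (α : Fin 3) (n : ℤ) {s : ℂ} (hs0 : s ≠ 0) (hs1 : ‖s‖ ≠ 1) :
    coloredBlock α n s hs0 hs1 = blockValue α n.natAbs s :=
  (Classical.epsilon_spec (p := IsColoredBlock α n s hs0 hs1)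
    ⟨_, isColoredBlock_blockValue α n hs0 hs1⟩).unique (isColoredBlock_blockValue α n hs0 hs1)

theorem neg_one_zpow_natAbs (n : ℤ) : (-1 : ℂ) ^ n = (-1) ^ n.natAbs := by
  rcases Int.natAbs_eq n with hn | hn
  · nth_rw 1 [hn]
    rw [zpow_natCast]
  · nth_rw 1 [hn]
    rw [zpow_neg, zpow_natCast, ← inv_pow]
    norm_num

theorem zpow_neg_sq_natAbs (s : ℂ) (n : ℤ) : s ^ (-n ^ 2) = (s ^ n.natAbs ^ 2)⁻¹ := by
  rw [← zpow_neg_natCast_sq, Int.natCast_natAbs, sq_abs]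

end

end Knot52

theorem mainTheorem4 (s q : ℂ) (hq : q = s ^ 2) (hs0 : s ≠ 0) (hs1 : ‖s‖ ≠ 1) :
    -- the defining expansions determine the colored holomorphic blocks
    (∀ (α : Fin 3) (n : ℤ), ∃! h : ℂ, Knot52.IsColoredBlock α n s hs0 hs1 h) ∧
    -- the series in the formulas converge
    (∀ N : ℕ, Summable (Knot52.term0 N q) ∧ Summable (Knot52.term1 N q) ∧
      Summable (Knot52.term2 N q)) ∧
    (∀ n : ℤ, Knot52.coloredBlock 0 n s hs0 hs1 =
      (-1) ^ n * s ^ n.natAbs * ∑' k : ℕ, Knot52.term0 n.natAbs q k) ∧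
    (∀ n : ℤ, Knot52.coloredBlock 1 n s hs0 hs1 =
      -(-1) ^ n * s ^ n.natAbs * ∑' k : ℕ, Knot52.term1 n.natAbs q k
      + s ^ (-n ^ 2) * ∑ k ∈ Finset.range n.natAbs,
          Knot52.qPoch q⁻¹ q⁻¹ (n.natAbs - 1 - k) /
            (Knot52.qPoch q⁻¹ q⁻¹ k * Knot52.qPoch q q (k + n.natAbs))) ∧
    (∀ n : ℤ, Knot52.coloredBlock 2 n s hs0 hs1 =
      (-1) ^ n * s ^ n.natAbs * ∑' k : ℕ, Knot52.term2 n.natAbs q k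
      + 2 * s ^ (-n ^ 2) * ∑ k ∈ Finset.range n.natAbs,
          Knot52.qPoch q⁻¹ q⁻¹ (n.natAbs - 1 - k) /
            (Knot52.qPoch q⁻¹ q⁻¹ k * Knot52.qPoch q q (k + n.natAbs)) *
          ((n.natAbs : ℂ) - 3 / 4 - 3 * Knot52.E 1 q + Knot52.H k q + Knot52.H (k + n.natAbs) q
            + Knot52.H (n.natAbs - k - 1) q)
      - 2 * (-1) ^ n * (s ^ n.natAbs)⁻¹ * ∑ k ∈ Finset.range n.natAbs,
          (q ^ (n.natAbs * k))⁻¹ *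
          (Knot52.qPoch q⁻¹ q⁻¹ (2 * n.natAbs - k - 1) *
            Knot52.qPoch q⁻¹ q⁻¹ (n.natAbs - k - 1) / Knot52.qPoch q⁻¹ q⁻¹ k)) ∧
    (∀ (α : Fin 3) (n : ℤ),
      Knot52.coloredBlock α (-n) s hs0 hs1 = Knot52.coloredBlock α n s hs0 hs1) := by
  subst hq
  refine ⟨fun α n => ⟨_, Knot52.isColoredBlock_blockValue α n hs0 hs1,
    fun y hy => hy.unique (Knot52.isColoredBlock_blockValue α n hs0 hs1)⟩,
    fun N => (Knot52.jets hs0 hs1 N).1, fun n => ?_, fun n => ?_, fun n => ?_, fun α n => ?_⟩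
  · rw [Knot52.coloredBlock_eq, Knot52.neg_one_zpow_natAbs, Knot52.blockValue]
  · rw [Knot52.coloredBlock_eq, Knot52.neg_one_zpow_natAbs, Knot52.zpow_neg_sq_natAbs,
      Knot52.blockValue]
    rfl
  · rw [Knot52.coloredBlock_eq, Knot52.neg_one_zpow_natAbs, Knot52.zpow_neg_sq_natAbs,
      Knot52.blockValue]
    rfl
  · rw [Knot52.coloredBlock_eq, Knot52.coloredBlock_eq, Int.natAbs_neg]
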